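/- **Theorem 3.3.** For $N\ge 2$ and $\gamma\ge 0$ let $$V_\gamma(x)=\sum_{i=1}^N\Bigl(\tfrac14x_i^4-\tfrac12x_i^2\Bigr)+\frac\gamma4\sum_{i=1}^N(x_{i+1}-x_i)^2,\qquad x\in\mathbb R^N,\quad x_{N+1}=x_1,$$ and consider its restriction $V_\gamma|_S$ to the hyperplane $S=\{x\in\mathbb R^N:\sum_i x_i=0\}$. A stationary point of $V_\gamma|_S$ is called nondegenerate if the Hessian of $V_\gamma|_S$ at that point is invertible; its index is the number of negative eigenvalues of this Hessian, counted with multiplicity. For integers $0\le a_0\le a_1\le a_2$, a point $x\in S$ has triple $(a_0,a_1,a_2)$ if, for some $\lambda\in\mathbb R$, the polynomial $\xi^3-\xi-\lambda$ has three distinct real roots $\alpha_0,\alpha_1,\alpha_2$, every coordinate of $x$ is one of them, and exactly $a_j$ coordinates equal $\alpha_j$ $(j=0,1,2)$. Let $N$ be even, $N\ge 8$, and not a multiple of $3$. For $0\le k\le\lfloor N/6\rfloor$ let $B_k$ be the set of nondegenerate stationary points of $V_0|_S$ of index $0$ (local minima) with triple $(0,\frac N2-k,\frac N2+k)$, and for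 $1\le k\le\lfloor N/6\rfloor$ let $C_k$ be the set of nondegenerate stationary points of $V_0|_S$ of index $1$ with triple $(1,\frac N2-k,\frac N2+k-1)$. Say that a stationary point $x^\star$ of $V_0|_S$ persists without changing its index for $\gamma$ in an interval $I\subset[0,\infty)$ containing $0$ if there is a continuous map $\gamma\mapsto x(\gamma)\in S$ on $I$ with $x(0)=x^\star$ such that, for every $\gamma\in I$, $x(\gamma)$ is a nondegenerate stationary point of $V_\gamma|_S$ with the same index as $x^\star$. 1. There is a constant $c>0$, independent of $N$ and $k$, such that for all such $N$, every point of $B_k$ $(0\le k\le\lfloor N/6\rfloor)$ and every point of $C_k$ $(1\le k\le\lfloor N/6\rfloor)$ persists without changing its index for $$0\le\gamma\le c\Bigl(\frac16-\frac kN\Bigr)^2 .$$ 2. For all such $N$, every point of $B_0$ persists without changing its index for $0\le\gamma<\frac73-\sqrt5$. -/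

import Mathlib

noncomputable section

namespace ACLattice

/-- The local double-well potential `U(ξ) = ξ⁴/4 - ξ²/2`. -/
def U (ξ : ℝ) : ℝ := ξ ^ 4 / 4 - ξ ^ 2 / 2

/-- The potential `V_γ` on `ℝ^Λ`, where `Λ = ℤ/Nℤ` is the periodic lattice. -/
def V (N : ℕ) [NeZero N] (γ : ℝ) (x : EuclideanSpace ℝ (ZMod N)) : ℝ :=
  (∑ i, U (x i)) + γ / 4 * ∑ i, (x (i + 1) - x i) ^ 2

/-- The hyperplane `S` of configurations of total mass zero. -/
def S (N : ℕ) [NeZero N] : Submodule ℝ (EuclideanSpace ℝ (ZMod N)) where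
  carrier := {x | ∑ i, x i = 0}
  add_mem' := by
    intro a b ha hb
    simp only [Set.mem_ofPred_eq] at *
    simp [Finset.sum_add_distrib, ha, hb]
  zero_mem' := by simp
  smul_mem' := by
    intro c a ha
    simp only [Set.mem_ofPred_eq] at *
    simp [← Finset.mul_sum, ha]

/-- The constrained potential: the restriction of `V_γ` to `S`. -/
def VS (N : ℕ) [NeZero N] (γ : ℝ) (y : S N) : ℝ := V N γ (y : EuclideanSpace ℝ (ZMod N))

/-- The Hessian of the constrained potential at `y`, as a linear operator on the Euclidean
space `S`: the derivative of the gradient. -/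
def hessian (N : ℕ) [NeZero N] (γ : ℝ) (y : S N) : S N →ₗ[ℝ] S N :=
  (fderiv ℝ (gradient (VS N γ)) y : S N →L[ℝ] S N)

/-- `y` is a nondegenerate stationary point of the constrained potential. -/
def IsNondegStationary (N : ℕ) [NeZero N] (γ : ℝ) (y : S N) : Prop :=
  gradient (VS N γ) y = 0 ∧ LinearMap.det (hessian N γ y) ≠ 0

/-- Morse index: the number of negative eigenvalues of the Hessian of the constrained
potential, counted with multiplicity (the dimension of the sum of their eigenspaces). -/
def morseIndex (N : ℕ) [NeZero N] (γ : ℝ) (y : S N) : ℕ :=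
  Module.finrank ℝ
    (⨆ μ : {μ : ℝ // μ < 0}, Module.End.eigenspace (hessian N γ y) (μ : ℝ) : Submodule ℝ (S N))

/-- The configuration `y` has triple `(a₀, a₁, a₂)`, `a₀ ≤ a₁ ≤ a₂`: every coordinate is one of
the three distinct real roots `α₀, α₁, α₂` of `ξ³ - ξ - l` for some real `l`, and exactly `a_j`
coordinates are equal to `α_j`. -/
def HasTriple {N : ℕ} [NeZero N] (y : S N) (a₀ a₁ a₂ : ℕ) : Prop :=
  a₀ ≤ a₁ ∧ a₁ ≤ a₂ ∧
  ∃ l α₀ α₁ α₂ : ℝ,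
    (α₀ ≠ α₁ ∧ α₀ ≠ α₂ ∧ α₁ ≠ α₂) ∧
    (α₀ ^ 3 - α₀ = l ∧ α₁ ^ 3 - α₁ = l ∧ α₂ ^ 3 - α₂ = l) ∧
    (∀ i, y.1 i = α₀ ∨ y.1 i = α₁ ∨ y.1 i = α₂) ∧
    Nat.card {i // y.1 i = α₀} = a₀ ∧
    Nat.card {i // y.1 i = α₁} = a₁ ∧
    Nat.card {i // y.1 i = α₂} = a₂

/-- The family `B_k` of local minima (nondegenerate stationary points of index `0`) of the
uncoupled constrained potential with triple `(0, N/2 - k, N/2 + k)`; used for `N` even and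
`0 ≤ k ≤ ⌊N/6⌋`. -/
def B (N : ℕ) [NeZero N] (k : ℕ) : Set (S N) :=
  {y | IsNondegStationary N 0 y ∧ morseIndex N 0 y = 0 ∧ HasTriple y 0 (N / 2 - k) (N / 2 + k)}

/-- The family `C_k` of `1`-saddles of the uncoupled constrained potential with triple
`(1, N/2 - k, N/2 + k - 1)`; used for `N` even and `1 ≤ k ≤ ⌊N/6⌋`. -/
def C (N : ℕ) [NeZero N] (k : ℕ) : Set (S N) :=
  {y | IsNondegStationary N 0 y ∧ morseIndex N 0 y = 1 ∧
    HasTriple y 1 (N / 2 - k) (N / 2 + k - 1)}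

/-- The stationary point `y` of the uncoupled system persists, without changing its index, for
the couplings in `I` (an interval starting at `0`): it is the starting point of a continuous
branch of nondegenerate stationary points of the constrained potential, of constant index. -/
def PersistsOn {N : ℕ} [NeZero N] (I : Set ℝ) (y : S N) : Prop :=
  ∃ x : ℝ → S N, ContinuousOn x I ∧ x 0 = y ∧
    ∀ γ ∈ I, IsNondegStationary N γ (x γ) ∧ morseIndex N γ (x γ) = morseIndex N 0 y

end ACLattice

end

/-! Stationarity on `S` is the equation `force γ x = const`, the constant being a Lagrange
multiplier. The uncoupled Hessian is the compression to `S` of a diagonal operator with entries `d i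
= 3 * x i ^ 2 - 1`.

Part 1 is a quantitative implicit function theorem in the sup norm, whose constants do not see `N`.
With `η = 1/6 - k/N`, every point of `B_k` or `C_k` satisfies `|d i| ≥ η`, and the compressed
diagonal operator has an inverse of norm at most `4 / η` (`WellConditioned.norm_solveDiag_le`).
Displacements to coupled stationary points are fixed points of a `1/2`-contraction of the ball of
radius `η / 240` as long as `γ ≤ η ^ 2 / 7680` (`exists_branch`). The same estimate for the
linearised equation gives nondegeneracy. The index follows from signs: in `B_k` all diagonal entries
stay positive; in `C_k` just one is negative, so the index is at most one, and a test vector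
supported on the defect and one well shows that it is not zero.

Part 2 is global. Points of `B_0` have coordinates `±1`. Outside `[7/10, 11/10]` the force of each
well is replaced by a line of slope `2/5`, so the modified gradient is strongly monotone and has a
unique zero, continuous in `γ`. A maximum principle (`IsModifiedSolution.mem_well`) confines this
zero to the region where nothing was modified, for all `γ ≤ 1/10`, and `7/3 - √5 < 1/10`. -/

namespace ACLattice

open Finset

/-! ### Gradient and Hessian of the constrained potential. -/

variable {N : ℕ} [NeZero N]

/-- The discrete Laplacian (with positive sign) on the periodic lattice. -/
noncomputable def lap (x : ZMod N → ℝ) (i : ZMod N) : ℝ := 2 * x i - x (i + 1) - x (i - 1)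

/-- The components of the gradient of `V_γ` on the full space. -/
noncomputable def force (γ : ℝ) (x : ZMod N → ℝ) (i : ZMod N) : ℝ := x i ^ 3 - x i + γ / 2 * lap x i

/-- The components of the Hessian of `V_γ` at `x`, applied to `v`, on the full space. -/
noncomputable def hessVec (γ : ℝ) (x v : ZMod N → ℝ) (i : ZMod N) : ℝ :=
  (3 * x i ^ 2 - 1) * v i + γ / 2 * lap v i

theorem sum_diff_mul_diff (x v : ZMod N → ℝ) :
    ∑ i, (x (i + 1) - x i) * (v (i + 1) - v i) = ∑ i, lap x i * v i := by
  have h : ∑ i, (x (i + 1) - x i) * v (i + 1) = ∑ i, (x i - x (i - 1)) * v i := by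
    rw [← Equiv.sum_comp (Equiv.addRight (1 : ZMod N)) (fun i => (x i - x (i - 1)) * v i)]
    simp
  simp only [mul_sub, sum_sub_distrib, h]
  rw [← sum_sub_distrib]
  refine sum_congr rfl fun i _ => ?_
  simp only [lap]
  ring

theorem sum_lap_mul_comm (x v : ZMod N → ℝ) : ∑ i, lap x i * v i = ∑ i, lap v i * x i := by
  rw [← sum_diff_mul_diff, ← sum_diff_mul_diff]
  exact sum_congr rfl fun i _ => mul_comm _ _

theorem sum_lap_mul_self_nonneg (v : ZMod N → ℝ) : 0 ≤ ∑ i, lap v i * v i := by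
  rw [← sum_diff_mul_diff]
  exact sum_nonneg fun i _ => mul_self_nonneg _

theorem sum_lap_mul_self_le (v : ZMod N → ℝ) : ∑ i, lap v i * v i ≤ 4 * ∑ i, v i ^ 2 := by
  rw [← sum_diff_mul_diff]
  have h : ∑ i, v (i + 1) ^ 2 = ∑ i, v i ^ 2 :=
    Equiv.sum_comp (Equiv.addRight (1 : ZMod N)) (fun i => v i ^ 2)
  calc ∑ i, (v (i + 1) - v i) * (v (i + 1) - v i)
      ≤ ∑ i, (2 * v (i + 1) ^ 2 + 2 * v i ^ 2) :=
        sum_le_sum fun i _ => by nlinarith [sq_nonneg (v (i + 1) + v i)]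
    _ = 4 * ∑ i, v i ^ 2 := by
        rw [sum_add_distrib, ← mul_sum, ← mul_sum, h]; ring

theorem sum_eq_zero_of_mem (w : S N) : ∑ i, w.1 i = 0 := w.2

/-- The orthogonal projection onto `S` of a vector given by its coordinates. -/
noncomputable def proj (N : ℕ) [NeZero N] : (ZMod N → ℝ) →L[ℝ] S N :=
  (S N).orthogonalProjectionOnto ∘L
    (EuclideanSpace.equiv (ZMod N) ℝ).symm.toContinuousLinearMap

theorem inner_eq_sum (v w : EuclideanSpace ℝ (ZMod N)) : inner ℝ v w = ∑ i, v i * w i := by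
  rw [PiLp.inner_apply]
  exact sum_congr rfl fun i _ => by simp [mul_comm]

theorem inner_proj (z : ZMod N → ℝ) (w : S N) : inner ℝ (proj N z) w = ∑ i, z i * w.1 i := by
  simp only [proj, ContinuousLinearMap.comp_apply]
  rw [Submodule.inner_orthogonalProjectionOnto_eq_of_mem_right, inner_eq_sum]
  rfl

theorem proj_eq_zero_of_const {z : ZMod N → ℝ} {l : ℝ} (h : ∀ i, z i = l) : proj N z = 0 := by
  refine ext_inner_right ℝ fun w => ?_
  rw [inner_proj]
  simp only [h, ← mul_sum, sum_eq_zero_of_mem, mul_zero, inner_zero_left]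

/-- The orthogonal complement of `S` is the line of constant vectors; this produces the Lagrange
multiplier. -/
theorem const_of_proj_eq_zero {z : ZMod N → ℝ} (h : proj N z = 0) : ∃ l, ∀ i, z i = l := by
  have hz : ∀ w : ZMod N → ℝ, ∑ i, w i = 0 → ∑ i, z i * w i = 0 := fun w hw => by
    have := inner_proj z ⟨WithLp.toLp 2 w, hw⟩
    rw [h, inner_zero_left] at this
    exact this.symm
  refine ⟨z 0, fun i => ?_⟩
  have := hz (fun j => (if j = i then 1 else 0) - (if j = 0 then 1 else 0)) (by simp)
  simp only [mul_sub, sum_sub_distrib, mul_ite, mul_one, mul_zero, sum_ite_eq', mem_univ,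
    if_true] at this
  linarith

/-- The `i`-th coordinate on `S`. -/
noncomputable def coord (i : ZMod N) : S N →L[ℝ] ℝ := EuclideanSpace.proj i ∘L (S N).subtypeL

theorem coord_apply (i : ZMod N) (y : S N) : coord i y = y.1 i := rfl

theorem hasGradientAt_VS (γ : ℝ) (y : S N) : HasGradientAt (VS N γ) (proj N (force γ y.1)) y := by
  rw [hasGradientAt_iff_hasFDerivAt]
  have hc : ∀ i : ZMod N, HasFDerivAt (fun y : S N => y.1 i) (coord i) y := fun i =>
    (coord i).hasFDerivAt
  have hU : ∀ i : ZMod N, HasFDerivAt (fun y : S N => U (y.1 i))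
      ((y.1 i ^ 3 - y.1 i) • coord i) y := fun i => by
    have hd : HasDerivAt U (y.1 i ^ 3 - y.1 i) (y.1 i) := by
      have h := ((hasDerivAt_pow 4 (y.1 i)).div_const 4).sub ((hasDerivAt_pow 2 (y.1 i)).div_const 2)
      refine h.congr_deriv ?_
      push_cast
      ring
    exact hd.comp_hasFDerivAt y (hc i)
  have hW : ∀ i : ZMod N, HasFDerivAt (fun y : S N => (y.1 (i + 1) - y.1 i) ^ 2)
      ((2 * (y.1 (i + 1) - y.1 i)) • (coord (i + 1) - coord i)) y := fun i => by
    refine (((hc (i + 1)).sub (hc i)).pow 2).congr_fderiv ?_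
    ext v
    simp
  have h := (HasFDerivAt.fun_sum (u := univ) fun i _ => hU i).add
    ((HasFDerivAt.fun_sum (u := univ) fun i _ => hW i).const_mul (γ / 4))
  refine h.congr_fderiv ?_
  ext w
  rw [InnerProductSpace.toDual_apply_apply, inner_proj]
  simp only [_root_.add_apply, _root_.sum_apply,
    _root_.smul_apply, _root_.sub_apply, coord_apply, smul_eq_mul, force,
    add_mul, sum_add_distrib, mul_assoc, ← mul_sum, sum_diff_mul_diff]
  ring

theorem gradient_VS (γ : ℝ) : gradient (VS N γ) = fun y : S N => proj N (force γ y.1) :=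
  funext fun y => (hasGradientAt_VS γ y).gradient

theorem hessian_apply (γ : ℝ) (y v : S N) : hessian N γ y v = proj N (hessVec γ y.1 v.1) := by
  have hc : ∀ i : ZMod N, HasFDerivAt (fun y : S N => y.1 i) (coord i) y := fun i =>
    (coord i).hasFDerivAt
  have hf : ∀ i : ZMod N, HasFDerivAt (fun y : S N => force γ y.1 i)
      ((3 * y.1 i ^ 2) • coord i - coord i +
        (γ / 2) • ((2 : ℝ) • coord i - coord (i + 1) - coord (i - 1))) y := fun i => by
    have := (((hc i).pow 3).sub (hc i)).add
      (((((hc i).const_mul 2).sub (hc (i + 1))).sub (hc (i - 1))).const_mul (γ / 2))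
    refine this.congr_fderiv ?_
    ext v
    simp
  have h := (proj N).hasFDerivAt.comp y (hasFDerivAt_pi.2 hf)
  rw [hessian, gradient_VS, show fderiv ℝ (fun y : S N => proj N (force γ y.1)) y = _ from h.fderiv]
  simp only [ContinuousLinearMap.coe_coe, ContinuousLinearMap.comp_apply]
  congr 1
  ext i
  simp only [ContinuousLinearMap.pi_apply, _root_.add_apply,
    _root_.smul_apply, _root_.sub_apply, coord_apply, smul_eq_mul,
    hessVec, lap]
  ring

theorem inner_hessian (γ : ℝ) (y v w : S N) :
    inner ℝ (hessian N γ y v) w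
      = ∑ i, (3 * y.1 i ^ 2 - 1) * v.1 i * w.1 i + γ / 2 * ∑ i, lap v.1 i * w.1 i := by
  rw [hessian_apply, inner_proj]
  simp only [hessVec, add_mul, sum_add_distrib, mul_assoc, ← mul_sum]

theorem hessian_isSymmetric (γ : ℝ) (y : S N) : (hessian N γ y).IsSymmetric := fun v w => by
  rw [inner_hessian, real_inner_comm, inner_hessian, sum_lap_mul_comm]
  congr 1
  exact sum_congr rfl fun i _ => by ring

theorem isNondegStationary_of {γ : ℝ} {y : S N} {l : ℝ} (hl : ∀ i, force γ y.1 i = l)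
    (hker : ∀ (v : S N) (m : ℝ), (∀ i, hessVec γ y.1 v.1 i = m) → v = 0) :
    IsNondegStationary N γ y := by
  refine ⟨by rw [gradient_VS]; exact proj_eq_zero_of_const hl, ?_⟩
  rw [Ne, LinearMap.det_eq_zero_iff_ker_ne_bot, not_not, LinearMap.ker_eq_bot']
  intro v hv
  rw [hessian_apply] at hv
  obtain ⟨m, hm⟩ := const_of_proj_eq_zero hv
  exact hker v m hm

theorem isNondegStationary_of_pos {γ : ℝ} {y : S N} {l : ℝ} (hl : ∀ i, force γ y.1 i = l)
    (hpos : ∀ v : S N, v ≠ 0 → 0 < inner ℝ (hessian N γ y v) v) :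
    IsNondegStationary N γ y := by
  refine isNondegStationary_of hl fun v m hm => ?_
  by_contra hv
  have := hpos v hv
  rw [hessian_apply, proj_eq_zero_of_const hm, inner_zero_left] at this
  exact lt_irrefl _ this

/-- The coupling only adds a nonnegative form. Positivity of the diagonal is asked only on the
support of `v`, so that the lemma also serves saddles, on the subspace of vectors vanishing at the
defect. -/
theorem inner_hessian_pos {γ : ℝ} (hγ : 0 ≤ γ) {y v : S N} (hv : v ≠ 0)
    (hd : ∀ i, v.1 i ≠ 0 → 0 < 3 * y.1 i ^ 2 - 1) : 0 < inner ℝ (hessian N γ y v) v := by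
  rw [inner_hessian]
  have h1 : 0 ≤ γ / 2 * ∑ i, lap v.1 i * v.1 i :=
    mul_nonneg (by linarith) (sum_lap_mul_self_nonneg _)
  have h2 : 0 < ∑ i, (3 * y.1 i ^ 2 - 1) * v.1 i * v.1 i := by
    refine sum_pos' (fun i _ => ?_) ?_
    · by_cases h : v.1 i = 0
      · simp [h]
      · rw [mul_assoc]
        exact mul_nonneg (hd i h).le (mul_self_nonneg _)
    · by_contra! hcon
      refine hv (Subtype.ext (PiLp.ext fun i => ?_))
      by_contra h
      have h' : v.1 i ≠ 0 := h
      have := hcon i (mem_univ i)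
      rw [mul_assoc] at this
      nlinarith [mul_pos (hd i h') (mul_self_pos.2 h')]
  linarith

/-! ### The index of a symmetric operator. -/

/-- The span of the eigenvectors with negative eigenvalue. -/
noncomputable def negSpace {E : Type*} [AddCommGroup E] [Module ℝ E] (T : E →ₗ[ℝ] E) : Submodule ℝ E :=
  ⨆ μ : {μ : ℝ // μ < 0}, Module.End.eigenspace T (μ : ℝ)

theorem negSpace_eq_bot_of_pos {E : Type*} [NormedAddCommGroup E] [InnerProductSpace ℝ E]
    {T : E →ₗ[ℝ] E} (hpos : ∀ v, v ≠ 0 → 0 < inner ℝ (T v) v) :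
    negSpace T = ⊥ := by
  rw [negSpace, iSup_eq_bot]
  rintro ⟨μ, hμ⟩
  rw [Submodule.eq_bot_iff]
  intro v hv
  by_contra h
  have := hpos v h
  rw [Module.End.mem_eigenspace_iff.1 hv, real_inner_smul_left] at this
  exact absurd this (not_lt.2 (mul_nonpos_of_nonpos_of_nonneg hμ.le real_inner_self_nonneg))

section Symmetric

variable {E : Type*} [NormedAddCommGroup E] [InnerProductSpace ℝ E] [FiniteDimensional ℝ E]
  {T : E →ₗ[ℝ] E}

theorem inner_map_self_eq_sum (hT : T.IsSymmetric) (v : E) :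
    inner ℝ (T v) v = ∑ i, hT.eigenvalues rfl i * inner ℝ (hT.eigenvectorBasis rfl i) v ^ 2 := by
  rw [← (hT.eigenvectorBasis rfl).sum_inner_mul_inner]
  refine sum_congr rfl fun i _ => ?_
  rw [hT v, hT.apply_eigenvectorBasis, inner_smul_right, real_inner_comm]
  simp only [RCLike.ofReal_real_eq_id, id]
  ring

theorem inner_map_self_nonpos (hT : T.IsSymmetric) {v : E} (hv : v ∈ negSpace T) :
    inner ℝ (T v) v ≤ 0 := by
  rw [inner_map_self_eq_sum hT]
  refine sum_nonpos fun i _ => ?_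
  rcases lt_or_ge (hT.eigenvalues rfl i) 0 with h | h
  · exact mul_nonpos_of_nonpos_of_nonneg h.le (sq_nonneg _)
  -- Eigenvectors for distinct eigenvalues are orthogonal, so `v` has no component along a
  -- nonnegative eigenvalue.
  · have : inner ℝ (hT.eigenvectorBasis rfl i) v = 0 := by
      refine Submodule.iSup_induction _ (motive := fun v =>
        inner ℝ (hT.eigenvectorBasis rfl i) v = 0) hv ?_ (inner_zero_right _) ?_
      · rintro ⟨μ, hμ⟩ w hw
        have hw' := Module.End.mem_eigenspace_iff.1 hw
        have h1 := hT (hT.eigenvectorBasis rfl i) w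
        rw [hT.apply_eigenvectorBasis, hw', inner_smul_left, inner_smul_right] at h1
        simp only [RCLike.ofReal_real_eq_id, id, conj_trivial] at h1
        have h2 : (hT.eigenvalues rfl i - μ) * inner ℝ (hT.eigenvectorBasis rfl i) w = 0 := by
          linarith
        exact (mul_eq_zero.1 h2).resolve_left (by linarith)
      · intro a b ha hb
        rw [inner_add_right, ha, hb, add_zero]
    rw [this]
    simp

theorem negSpace_ne_bot (hT : T.IsSymmetric) {v : E} (hv : inner ℝ (T v) v < 0) :
    negSpace T ≠ ⊥ := by
  have : ∃ i, hT.eigenvalues rfl i < 0 := by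
    by_contra! h
    rw [inner_map_self_eq_sum hT] at hv
    exact absurd hv (not_lt.2 (sum_nonneg fun i _ => mul_nonneg (h i) (sq_nonneg _)))
  obtain ⟨i, hi⟩ := this
  intro hbot
  have hmem : hT.eigenvectorBasis rfl i ∈ negSpace T := by
    refine (le_iSup (fun μ : {μ : ℝ // μ < 0} => Module.End.eigenspace T (μ : ℝ)) ⟨_, hi⟩) ?_
    rw [Module.End.mem_eigenspace_iff, hT.apply_eigenvectorBasis]
    rfl
  rw [hbot, Submodule.mem_bot] at hmem
  have := (hT.eigenvectorBasis rfl).orthonormal.ne_zero i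
  exact this hmem

/-- The form is nonpositive on `negSpace T` and positive on the kernel of `φ` away from zero, so `φ`
is injective on `negSpace T`, whose dimension is therefore at most one. -/
theorem finrank_negSpace_eq_one (hT : T.IsSymmetric) (φ : E →ₗ[ℝ] ℝ)
    (hpos : ∀ v, v ≠ 0 → φ v = 0 → 0 < inner ℝ (T v) v) {w : E} (hw : inner ℝ (T w) w < 0) :
    Module.finrank ℝ (negSpace T) = 1 := by
  have h1 : Module.finrank ℝ (negSpace T) ≤ 1 := by
    have hinj : Function.Injective (φ ∘ₗ (negSpace T).subtype) := by
      rw [← LinearMap.ker_eq_bot, LinearMap.ker_eq_bot']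
      intro v hv
      by_contra h
      have h' : (v : E) ≠ 0 := fun h0 => h (Subtype.ext h0)
      exact absurd (hpos v h' hv) (not_lt.2 (inner_map_self_nonpos hT v.2))
    simpa using LinearMap.finrank_le_finrank_of_injective hinj
  have h2 : 0 < Module.finrank ℝ (negSpace T) := by
    rw [Nat.pos_iff_ne_zero, Ne, Submodule.finrank_eq_zero]
    exact negSpace_ne_bot hT hw
  omega

end Symmetric

theorem morseIndex_eq (γ : ℝ) (y : S N) :
    morseIndex N γ y = Module.finrank ℝ (negSpace (hessian N γ y)) := rfl

theorem morseIndex_eq_zero {γ : ℝ} {y : S N}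
    (hpos : ∀ v : S N, v ≠ 0 → 0 < inner ℝ (hessian N γ y v) v) : morseIndex N γ y = 0 := by
  rw [morseIndex_eq, negSpace_eq_bot_of_pos hpos, finrank_bot]

theorem morseIndex_eq_one {γ : ℝ} (hγ : 0 ≤ γ) {y w : S N} {j : ZMod N}
    (hd : ∀ i, i ≠ j → 0 < 3 * y.1 i ^ 2 - 1) (hw : inner ℝ (hessian N γ y w) w < 0) :
    morseIndex N γ y = 1 := by
  rw [morseIndex_eq]
  refine finrank_negSpace_eq_one (hessian_isSymmetric γ y) (coord j).toLinearMap
    (fun v hv hvj => inner_hessian_pos hγ hv fun i hi => hd i ?_) hw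
  rintro rfl
  exact hi hvj

/-! ### Contraction argument in the sup norm. -/

theorem abs_lap_le {N : ℕ} {x : ZMod N → ℝ} {c : ℝ} (h : ∀ i, |x i| ≤ c) (i : ZMod N) :
    |lap x i| ≤ 4 * c := by
  have h0 := abs_le.1 (h i)
  have h1 := abs_le.1 (h (i + 1))
  have h2 := abs_le.1 (h (i - 1))
  rw [lap, abs_le]
  constructor <;> linarith [h0.1, h0.2, h1.1, h1.2, h2.1, h2.2]

/-- The inverse of a diagonal operator compressed to the vectors of zero sum. -/
noncomputable def solveDiag (d v : ZMod N → ℝ) (i : ZMod N) : ℝ :=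
  (v i - (∑ j, v j / d j) / ∑ j, 1 / d j) / d i

/-- A quantitative invertibility condition on a diagonal operator compressed to the vectors of
zero sum. -/
structure WellConditioned (d : ZMod N → ℝ) (η : ℝ) : Prop where
  pos : 0 < η
  le_one : η ≤ 1
  le_abs : ∀ i, η ≤ |d i|
  sum_abs_le : ∑ i, 1 / |d i| ≤ 3 * ∑ i, 1 / d i

namespace WellConditioned

variable {d : ZMod N → ℝ} {η : ℝ}

theorem abs_pos (h : WellConditioned d η) (i : ZMod N) : 0 < |d i| :=
  h.pos.trans_le (h.le_abs i)

theorem ne_zero (h : WellConditioned d η) (i : ZMod N) : d i ≠ 0 := _root_.abs_pos.1 (h.abs_pos i)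

theorem sum_inv_pos (h : WellConditioned d η) : 0 < ∑ i, 1 / d i := by
  have : 0 < ∑ i, 1 / |d i| :=
    sum_pos (fun i _ => one_div_pos.2 (h.abs_pos i)) univ_nonempty
  linarith [h.sum_abs_le]

theorem sum_solveDiag (h : WellConditioned d η) (v : ZMod N → ℝ) : ∑ i, solveDiag d v i = 0 := by
  have hs := h.sum_inv_pos.ne'
  simp only [solveDiag, sub_div, sum_sub_distrib]
  rw [sub_eq_zero]
  conv_rhs => enter [2, i]; rw [div_eq_mul_one_div]
  rw [← mul_sum, div_mul_cancel₀ _ hs]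

theorem exists_mul_solveDiag (h : WellConditioned d η) (v : ZMod N → ℝ) :
    ∃ m, ∀ i, d i * solveDiag d v i = v i - m :=
  ⟨_, fun i => mul_div_cancel₀ _ (h.ne_zero i)⟩

theorem eq_solveDiag (h : WellConditioned d η) {u v : ZMod N → ℝ} {m : ℝ} (hu : ∑ i, u i = 0)
    (huv : ∀ i, d i * u i = v i - m) : u = solveDiag d v := by
  have hs := h.sum_inv_pos.ne'
  have hu' : ∀ i, u i = (v i - m) / d i := fun i => by
    rw [eq_div_iff (h.ne_zero i), mul_comm, huv]
  have hm : (∑ j, v j / d j) / ∑ j, 1 / d j = m := by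
    rw [div_eq_iff hs, mul_sum, ← sub_eq_zero, ← sum_sub_distrib, ← hu]
    exact sum_congr rfl fun i _ => by rw [hu' i]; ring
  funext i
  rw [solveDiag, hm, hu']

theorem solveDiag_sub (v w : ZMod N → ℝ) :
    solveDiag d v - solveDiag d w = solveDiag d (fun i => v i - w i) := by
  funext i
  simp only [Pi.sub_apply, solveDiag, sub_div, sum_sub_distrib]
  ring

/-- The multiplier is an average of `v` with weights `1 / d j`, possibly of both signs; `sum_abs_le`
bounds it by `3 * c`. The numerator is then at most `4 * c`, uniformly in `N`. -/
theorem norm_solveDiag_le (h : WellConditioned d η) {v : ZMod N → ℝ} {c : ℝ}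
    (hv : ∀ i, |v i| ≤ c) : ‖solveDiag d v‖ ≤ 4 / η * c := by
  have hc : 0 ≤ c := (abs_nonneg _).trans (hv 0)
  have hη := h.pos
  have hs := h.sum_inv_pos
  have hm : |(∑ j, v j / d j) / ∑ j, 1 / d j| ≤ 3 * c := by
    rw [abs_div, abs_of_pos hs, div_le_iff₀ hs]
    calc |∑ j, v j / d j| ≤ ∑ j, |v j / d j| := abs_sum_le_sum_abs _ _
      _ ≤ ∑ j, c * (1 / |d j|) := sum_le_sum fun j _ => by
          rw [abs_div, div_eq_mul_one_div]
          exact mul_le_mul_of_nonneg_right (hv j) (one_div_nonneg.2 (abs_nonneg _))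
      _ = c * ∑ j, 1 / |d j| := by rw [mul_sum]
      _ ≤ c * (3 * ∑ j, 1 / d j) := mul_le_mul_of_nonneg_left h.sum_abs_le hc
      _ = 3 * c * ∑ j, 1 / d j := by ring
  refine (pi_norm_le_iff_of_nonneg (by positivity)).2 fun i => ?_
  rw [Real.norm_eq_abs, solveDiag, abs_div]
  calc |v i - (∑ j, v j / d j) / ∑ j, 1 / d j| / |d i| ≤ (4 * c) / η := by
        refine div_le_div₀ (by positivity) ?_ hη (h.le_abs i)
        refine (abs_sub _ _).trans ?_
        linarith [hv i]
    _ = 4 / η * c := by ring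

end WellConditioned

/-- The map whose fixed points `u` are the displacements from a stationary point `x` of the
uncoupled system to stationary points of the system with coupling `γ`. -/
noncomputable def displacementMap (x : ZMod N → ℝ) (γ : ℝ) (u : ZMod N → ℝ) : ZMod N → ℝ :=
  solveDiag (fun i => 3 * x i ^ 2 - 1)
    fun i => -(3 * x i * u i ^ 2 + u i ^ 3 + γ / 2 * lap (fun j => x j + u j) i)

variable {x : ZMod N → ℝ} {η : ℝ}

theorem abs_le_of_norm_le {u : ZMod N → ℝ} {c : ℝ} (h : ‖u‖ ≤ c) (i : ZMod N) : |u i| ≤ c :=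
  (norm_le_pi_norm u i).trans h

theorem displacementMap_lipschitz (h : WellConditioned (fun i => 3 * x i ^ 2 - 1) η)
    (hx : ∀ i, |x i| ≤ 2) {γ : ℝ} (hγ : γ ∈ Set.Icc 0 (η ^ 2 / 7680)) {u v : ZMod N → ℝ}
    (hu : ‖u‖ ≤ η / 240) (hv : ‖v‖ ≤ η / 240) :
    ‖displacementMap x γ u - displacementMap x γ v‖ ≤ 1 / 2 * ‖u - v‖ := by
  have hη := h.pos
  have hη1 := h.le_one
  -- Since the inverse costs `4 / η`, a Lipschitz constant `η / 8` of the source term suffices: `η /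
  -- 16` from the nonlinearity on the ball and `η / 16` from the coupling.
  rw [displacementMap, displacementMap, WellConditioned.solveDiag_sub]
  have key : ∀ i, |-(3 * x i * u i ^ 2 + u i ^ 3 + γ / 2 * lap (fun j => x j + u j) i) -
      -(3 * x i * v i ^ 2 + v i ^ 3 + γ / 2 * lap (fun j => x j + v j) i)|
      ≤ η / 8 * ‖u - v‖ := fun i => by
    have huv : ∀ j, |u j - v j| ≤ ‖u - v‖ := fun j => norm_le_pi_norm (u - v) j
    have hlap : |lap (fun j => u j - v j) i| ≤ 4 * ‖u - v‖ := abs_lap_le huv i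
    have e : -(3 * x i * u i ^ 2 + u i ^ 3 + γ / 2 * lap (fun j => x j + u j) i) -
        -(3 * x i * v i ^ 2 + v i ^ 3 + γ / 2 * lap (fun j => x j + v j) i)
        = -((3 * x i * (u i + v i) + (u i ^ 2 + u i * v i + v i ^ 2)) * (u i - v i)
          + γ / 2 * lap (fun j => u j - v j) i) := by
      simp only [lap]
      ring
    rw [e, abs_neg]
    have hu' := abs_le_of_norm_le hu i
    have hv' := abs_le_of_norm_le hv i
    have h1 : |3 * x i * (u i + v i) + (u i ^ 2 + u i * v i + v i ^ 2)| ≤ η / 16 := by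
      have a1 : |3 * x i * (u i + v i)| ≤ 3 * 2 * (η / 240 + η / 240) := by
        rw [abs_mul, abs_mul, abs_of_pos (by norm_num : (0 : ℝ) < 3)]
        gcongr
        · exact hx i
        · exact (abs_add_le _ _).trans (add_le_add hu' hv')
      have a2 : |u i ^ 2 + u i * v i + v i ^ 2| ≤ 3 * (η / 240) ^ 2 := by
        refine (abs_add_three _ _ _).trans ?_
        rw [abs_pow, abs_pow, abs_mul]
        have b1 : |u i| ^ 2 ≤ (η / 240) ^ 2 := by gcongr
        have b2 : |v i| ^ 2 ≤ (η / 240) ^ 2 := by gcongr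
        have b3 : |u i| * |v i| ≤ (η / 240) * (η / 240) := by gcongr
        linarith
      refine (abs_add_le _ _).trans ?_
      nlinarith
    refine (abs_add_le _ _).trans ?_
    rw [abs_mul, abs_mul, abs_of_nonneg (by linarith [hγ.1] : 0 ≤ γ / 2)]
    have c1 : |3 * x i * (u i + v i) + (u i ^ 2 + u i * v i + v i ^ 2)| * |u i - v i|
        ≤ η / 16 * ‖u - v‖ := by
      gcongr
      exact huv i
    have c2 : γ / 2 * |lap (fun j => u j - v j) i| ≤ (η / 32 / 2) * (4 * ‖u - v‖) := by
      gcongr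
      nlinarith [hγ.2]
    linarith
  refine (h.norm_solveDiag_le key).trans (le_of_eq ?_)
  field_simp
  ring

theorem displacementMap_sub_coupling (h : WellConditioned (fun i => 3 * x i ^ 2 - 1) η)
    (hx : ∀ i, |x i| ≤ 2) (γ γ' : ℝ) {u : ZMod N → ℝ} (hu : ‖u‖ ≤ η / 240) :
    ‖displacementMap x γ u - displacementMap x γ' u‖ ≤ 20 / η * |γ - γ'| := by
  have hη := h.pos
  rw [displacementMap, displacementMap, WellConditioned.solveDiag_sub]
  have key : ∀ i, |-(3 * x i * u i ^ 2 + u i ^ 3 + γ / 2 * lap (fun j => x j + u j) i) -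
      -(3 * x i * u i ^ 2 + u i ^ 3 + γ' / 2 * lap (fun j => x j + u j) i)|
      ≤ 5 * |γ - γ'| := fun i => by
    have hb : |lap (fun j => x j + u j) i| ≤ 4 * (5 / 2) := abs_lap_le (fun j => by
      refine (abs_add_le _ _).trans ?_
      linarith [hx j, abs_le_of_norm_le hu j, h.le_one]) i
    have e : -(3 * x i * u i ^ 2 + u i ^ 3 + γ / 2 * lap (fun j => x j + u j) i) -
        -(3 * x i * u i ^ 2 + u i ^ 3 + γ' / 2 * lap (fun j => x j + u j) i)
        = -((γ - γ') / 2 * lap (fun j => x j + u j) i) := by ring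
    rw [e, abs_neg, abs_mul, abs_div, abs_two]
    nlinarith [abs_nonneg (γ - γ')]
  refine (h.norm_solveDiag_le key).trans (le_of_eq ?_)
  ring

theorem displacementMap_zero : displacementMap x 0 0 = 0 := by
  funext i
  simp [displacementMap, solveDiag]

theorem exists_fixedPoint_displacementMap (h : WellConditioned (fun i => 3 * x i ^ 2 - 1) η)
    (hx : ∀ i, |x i| ≤ 2) {γ : ℝ} (hγ : γ ∈ Set.Icc 0 (η ^ 2 / 7680)) :
    ∃ u : ZMod N → ℝ, ‖u‖ ≤ η / 240 ∧ displacementMap x γ u = u := by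
  have hη := h.pos
  have hlip := fun u v => displacementMap_lipschitz h hx hγ (u := u) (v := v)
  have h0 : ‖(0 : ZMod N → ℝ)‖ ≤ η / 240 := by rw [norm_zero]; positivity
  -- The origin must move by at most half the radius for the ball to be preserved. Its image has
  -- norm at most `16 * γ / η`, whence `7680 = 16 * 480`.
  have hT0 : ‖displacementMap x γ 0‖ ≤ η / 480 := by
    have key : ∀ i, |-(3 * x i * (0 : ZMod N → ℝ) i ^ 2 + (0 : ZMod N → ℝ) i ^ 3 +
        γ / 2 * lap (fun j => x j + (0 : ZMod N → ℝ) j) i)| ≤ η ^ 2 / 7680 / 2 * (4 * 2) :=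
      fun i => by
      have hb : |lap (fun j => x j + (0 : ZMod N → ℝ) j) i| ≤ 4 * 2 :=
        abs_lap_le (fun j => by simpa using hx j) i
      have e : -(3 * x i * (0 : ZMod N → ℝ) i ^ 2 + (0 : ZMod N → ℝ) i ^ 3 +
        γ / 2 * lap (fun j => x j + (0 : ZMod N → ℝ) j) i)
        = -(γ / 2 * lap (fun j => x j + (0 : ZMod N → ℝ) j) i) := by simp
      rw [e, abs_neg, abs_mul, abs_of_nonneg (by linarith [hγ.1] : 0 ≤ γ / 2)]
      gcongr
      exact hγ.2
    refine (h.norm_solveDiag_le key).trans (le_of_eq ?_)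
    field_simp
    ring
  have hmaps : Set.MapsTo (displacementMap x γ) (Metric.closedBall 0 (η / 240))
      (Metric.closedBall 0 (η / 240)) := fun u hu => by
    rw [mem_closedBall_zero_iff] at hu ⊢
    have h1 := hlip u 0 hu h0
    rw [sub_zero] at h1
    have h2 := norm_le_norm_add_norm_sub' (displacementMap x γ u) (displacementMap x γ 0)
    linarith
  have hcontr : ContractingWith (1 / 2) (hmaps.restrict _ _ _) := by
    refine ⟨by norm_num, LipschitzWith.of_dist_le_mul fun u v => ?_⟩
    have hu := mem_closedBall_zero_iff.1 u.2
    have hv := mem_closedBall_zero_iff.1 v.2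
    rw [Subtype.dist_eq, Subtype.dist_eq, dist_eq_norm, dist_eq_norm]
    simpa using hlip u v hu hv
  obtain ⟨u, hu, hfix, -⟩ := hcontr.exists_fixedPoint' Metric.isClosed_closedBall.isComplete hmaps
    (Metric.mem_closedBall_self (by positivity)) (edist_ne_top _ _)
  exact ⟨u, mem_closedBall_zero_iff.1 hu, hfix⟩

theorem exists_branch (h : WellConditioned (fun i => 3 * x i ^ 2 - 1) η) (hx : ∀ i, |x i| ≤ 2)
    {l : ℝ} (hl : ∀ i, x i ^ 3 - x i = l) :
    ∃ u : ℝ → ZMod N → ℝ, ContinuousOn u (Set.Icc 0 (η ^ 2 / 7680)) ∧ u 0 = 0 ∧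
      (∀ γ, ∑ i, u γ i = 0) ∧ ∀ γ ∈ Set.Icc 0 (η ^ 2 / 7680), ‖u γ‖ ≤ η / 240 ∧
        ∃ m, ∀ i, force γ (fun j => x j + u γ j) i = m := by
  have hη := h.pos
  have hex : ∀ γ, ∃ u : ZMod N → ℝ, ∑ i, u i = 0 ∧ (γ ∈ Set.Icc 0 (η ^ 2 / 7680) →
      ‖u‖ ≤ η / 240 ∧ displacementMap x γ u = u) := fun γ => by
    by_cases hγ : γ ∈ Set.Icc 0 (η ^ 2 / 7680)
    · obtain ⟨u, hu, hfix⟩ := exists_fixedPoint_displacementMap h hx hγ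
      refine ⟨u, ?_, fun _ => ⟨hu, hfix⟩⟩
      rw [← hfix]
      exact h.sum_solveDiag _
    · exact ⟨0, by simp, fun h => absurd h hγ⟩
  choose u hsum hu using hex
  -- Fixed points of `1/2`-contractions depend on the parameter with at most twice the Lipschitz
  -- constant of the maps.
  have hest : ∀ γ ∈ Set.Icc 0 (η ^ 2 / 7680), ∀ γ' ∈ Set.Icc 0 (η ^ 2 / 7680),
      ‖u γ - u γ'‖ ≤ 40 / η * |γ - γ'| := fun γ hγ γ' hγ' => by
    obtain ⟨h1, h2⟩ := hu γ hγ
    obtain ⟨h1', h2'⟩ := hu γ' hγ'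
    have e1 := displacementMap_lipschitz h hx hγ h1 h1'
    have e2 := displacementMap_sub_coupling h hx γ γ' h1'
    have e3 := norm_add_le (displacementMap x γ (u γ) - displacementMap x γ (u γ'))
      (displacementMap x γ (u γ') - displacementMap x γ' (u γ'))
    rw [sub_add_sub_cancel, h2, h2'] at e3
    rw [h2] at e1
    rw [h2'] at e2
    have : 40 / η * |γ - γ'| = 2 * (20 / η * |γ - γ'|) := by ring
    linarith
  have hz : (0 : ℝ) ∈ Set.Icc 0 (η ^ 2 / 7680) := ⟨le_rfl, by positivity⟩
  refine ⟨u, ?_, ?_, hsum, fun γ hγ => ⟨(hu γ hγ).1, ?_⟩⟩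
  · refine (LipschitzOnWith.of_dist_le_mul (K := ⟨40 / η, by positivity⟩) fun γ hγ γ' hγ' => ?_).continuousOn
    rw [dist_eq_norm, Real.dist_eq]
    exact hest γ hγ γ' hγ'
  · obtain ⟨h1, h2⟩ := hu 0 hz
    have e1 := displacementMap_lipschitz h hx hz h1 (v := 0) (by rw [norm_zero]; positivity)
    rw [h2, displacementMap_zero, sub_zero] at e1
    exact norm_le_zero_iff.1 (by linarith)
  · obtain ⟨m, hm⟩ := h.exists_mul_solveDiag (fun i => -(3 * x i * u γ i ^ 2 + u γ i ^ 3 +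
        γ / 2 * lap (fun j => x j + u γ j) i))
    rw [← displacementMap, (hu γ hγ).2] at hm
    refine ⟨l - m, fun i => ?_⟩
    rw [force, ← hl i]
    linear_combination hm i

/-- A vector near a well-conditioned stationary point has a nondegenerate constrained Hessian. -/
theorem eq_zero_of_hessVec_const (h : WellConditioned (fun i => 3 * x i ^ 2 - 1) η)
    (hx : ∀ i, |x i| ≤ 2) {γ : ℝ} (hγ : γ ∈ Set.Icc 0 (η ^ 2 / 7680)) {u v : ZMod N → ℝ}
    (hu : ‖u‖ ≤ η / 240) (hv : ∑ i, v i = 0) {m : ℝ}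
    (hm : ∀ i, hessVec γ (fun j => x j + u j) v i = m) : v = 0 := by
  have hη := h.pos
  have hη1 := h.le_one
  have e := h.eq_solveDiag hv (v := fun i => -((6 * x i * u i + 3 * u i ^ 2) * v i
    + γ / 2 * lap v i)) (m := -m) fun i => by
      rw [← hm i, hessVec]
      ring
  have key : ∀ i, |-((6 * x i * u i + 3 * u i ^ 2) * v i + γ / 2 * lap v i)|
      ≤ η / 8 * ‖v‖ := fun i => by
    have hlap : |lap v i| ≤ 4 * ‖v‖ := abs_lap_le (norm_le_pi_norm v) i
    have hu' := abs_le_of_norm_le hu i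
    have h1 : |6 * x i * u i + 3 * u i ^ 2| ≤ η / 16 := by
      have a1 : |6 * x i * u i| ≤ 6 * 2 * (η / 240) := by
        rw [abs_mul, abs_mul, abs_of_pos (by norm_num : (0 : ℝ) < 6)]
        gcongr
        exact hx i
      have a2 : |3 * u i ^ 2| ≤ 3 * (η / 240) ^ 2 := by
        rw [abs_mul, abs_of_pos (by norm_num : (0 : ℝ) < 3), abs_pow]
        gcongr
      refine (abs_add_le _ _).trans ?_
      nlinarith
    rw [abs_neg]
    refine (abs_add_le _ _).trans ?_
    rw [abs_mul, abs_mul, abs_of_nonneg (by linarith [hγ.1] : 0 ≤ γ / 2)]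
    have c1 : |6 * x i * u i + 3 * u i ^ 2| * |v i| ≤ η / 16 * ‖v‖ := by
      gcongr
      exact norm_le_pi_norm v i
    have c2 : γ / 2 * |lap v i| ≤ (η / 32 / 2) * (4 * ‖v‖) := by
      gcongr
      nlinarith [hγ.2]
    linarith
  have h1 := h.norm_solveDiag_le key
  rw [← e] at h1
  have h2 : 4 / η * (η / 8 * ‖v‖) = 1 / 2 * ‖v‖ := by
    field_simp
    ring
  exact norm_le_zero_iff.1 (by linarith)

/-- A family of vectors of zero sum, seen as a family of points of `S`. -/
noncomputable def toS (x : ZMod N → ℝ) (hx : ∑ i, x i = 0) : S N := ⟨WithLp.toLp 2 x, hx⟩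

theorem continuousOn_toS {x : ℝ → ZMod N → ℝ} (hx : ∀ γ, ∑ i, x γ i = 0) {I : Set ℝ}
    (hc : ContinuousOn x I) : ContinuousOn (fun γ => toS (x γ) (hx γ)) I :=
  Topology.IsInducing.subtypeVal.continuousOn_iff.2
    ((PiLp.continuous_toLp 2 _).comp_continuousOn hc)

theorem persistsOn_of_wellConditioned {y : S N} {η : ℝ}
    (h : WellConditioned (fun i => 3 * y.1 i ^ 2 - 1) η) (hy : ∀ i, |y.1 i| ≤ 2) {l : ℝ}
    (hl : ∀ i, y.1 i ^ 3 - y.1 i = l)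
    (hindex : ∀ γ ∈ Set.Icc 0 (η ^ 2 / 7680), ∀ z : S N, (∀ i, |z.1 i - y.1 i| ≤ η / 240) →
      morseIndex N γ z = morseIndex N 0 y) :
    PersistsOn (Set.Icc 0 (η ^ 2 / 7680)) y := by
  obtain ⟨u, hc, h0, hsum, hu⟩ := exists_branch h hy hl
  have hs : ∀ γ, ∑ i, (y.1 i + u γ i) = 0 := fun γ => by
    rw [sum_add_distrib, hsum, sum_eq_zero_of_mem, add_zero]
  refine ⟨fun γ => toS (fun i => y.1 i + u γ i) (hs γ), ?_, ?_, fun γ hγ => ⟨?_, ?_⟩⟩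
  · exact continuousOn_toS hs (continuousOn_const.add hc)
  · refine Subtype.ext (PiLp.ext fun i => ?_)
    simp [toS, h0]
  · obtain ⟨hn, m, hm⟩ := hu γ hγ
    refine isNondegStationary_of hm fun v m' hm' => ?_
    have := eq_zero_of_hessVec_const h hy hγ hn (sum_eq_zero_of_mem v) hm'
    exact Subtype.ext (PiLp.ext fun i => congrFun this i)
  · refine hindex γ hγ _ fun i => ?_
    simpa [toS] using abs_le_of_norm_le (hu γ hγ).1 i

theorem abs_second_deriv_sub_le {a b η : ℝ} (hη : η ≤ 1) (ha : |a| ≤ 2) (hb : |b - a| ≤ η / 240) :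
    |(3 * b ^ 2 - 1) - (3 * a ^ 2 - 1)| ≤ η / 16 := by
  have h0 : 0 ≤ η / 240 := (abs_nonneg _).trans hb
  have e : (3 * b ^ 2 - 1) - (3 * a ^ 2 - 1) = (6 * a + 3 * (b - a)) * (b - a) := by ring
  rw [e, abs_mul]
  have h1 : |6 * a + 3 * (b - a)| ≤ 15 := by
    refine (abs_add_le _ _).trans ?_
    rw [abs_mul, abs_mul, abs_of_pos (by norm_num : (0 : ℝ) < 6),
      abs_of_pos (by norm_num : (0 : ℝ) < 3)]
    linarith
  calc |6 * a + 3 * (b - a)| * |b - a| ≤ 15 * (η / 240) := by gcongr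
    _ = η / 16 := by ring

/-! ### Stationary points of the uncoupled system. -/

theorem sum_ite_eq_natCard (x : ZMod N → ℝ) (a : ℝ) :
    ∑ i, (if x i = a then (1 : ℝ) else 0) = (Nat.card {i // x i = a} : ℝ) := by
  rw [sum_boole, Nat.card_eq_fintype_card, Fintype.card_subtype]

theorem sum_of_three_values {x : ZMod N → ℝ} {a b c : ℝ} (hab : a ≠ b) (hac : a ≠ c) (hbc : b ≠ c)
    (hx : ∀ i, x i = a ∨ x i = b ∨ x i = c) :
    ∑ i, x i = Nat.card {i // x i = a} * a + Nat.card {i // x i = b} * b +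
      Nat.card {i // x i = c} * c := by
  simp only [← sum_ite_eq_natCard, sum_mul, ← sum_add_distrib]
  refine sum_congr rfl fun i _ => ?_
  rcases hx i with h | h | h <;> simp [h, hab, hac, hbc, hab.symm, hac.symm, hbc.symm]

theorem quadratic_of_cubic_eq {a b : ℝ} (hab : a ≠ b) (h : a ^ 3 - a = b ^ 3 - b) :
    a ^ 2 + a * b + b ^ 2 = 1 := by
  have : (a - b) * (a ^ 2 + a * b + b ^ 2 - 1) = 0 := by linear_combination h
  linarith [(mul_eq_zero.1 this).resolve_left (sub_ne_zero.2 hab)]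

theorem add_eq_neg_of_cubic_eq {a b c : ℝ} (hab : a ≠ b) (hac : a ≠ c) (hbc : b ≠ c)
    (h1 : a ^ 3 - a = b ^ 3 - b) (h2 : a ^ 3 - a = c ^ 3 - c) : a = -(b + c) := by
  have e1 := quadratic_of_cubic_eq hab h1
  have e2 := quadratic_of_cubic_eq hac h2
  have : (b - c) * (a + b + c) = 0 := by linear_combination e1 - e2
  linarith [(mul_eq_zero.1 this).resolve_left (sub_ne_zero.2 hbc)]

theorem abs_le_two_of_quadratic {a b : ℝ} (h : a ^ 2 + a * b + b ^ 2 = 1) : |a| ≤ 2 :=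
  abs_le_of_sq_le_sq (by nlinarith [sq_nonneg (a + 2 * b)]) (by norm_num)

theorem second_deriv_ge_of_two_wells {a b t : ℝ} (ht : 0 ≤ t) (ht' : t ≤ 1 / 6)
    (hq : a ^ 2 + a * b + b ^ 2 = 1) (hs : (1 / 2 - t) * a + (1 / 2 + t) * b = 0) :
    1 / 6 - t ≤ 3 * a ^ 2 - 1 ∧ 1 / 6 - t ≤ 3 * b ^ 2 - 1 := by
  -- The zero-sum constraint fixes `a` and `b` up to the scale `s`, which the quadratic relation
  -- then determines.
  obtain ⟨s, hsd⟩ : ∃ s, s = a - b := ⟨_, rfl⟩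
  have ha : a = (1 / 2 + t) * s := by rw [hsd]; linear_combination hs
  have hb : b = -(1 / 2 - t) * s := by rw [hsd]; linear_combination hs
  have hs2 : s ^ 2 * (1 / 4 + 3 * t ^ 2) = 1 := by
    rw [ha, hb] at hq
    linear_combination hq
  have hs3 : 1 ≤ s ^ 2 := by nlinarith [sq_nonneg s]
  have ea : 3 * a ^ 2 - 1 = s ^ 2 * (1 / 2 + 3 * t) := by rw [ha]; linear_combination hs2
  have eb : 3 * b ^ 2 - 1 = s ^ 2 * (1 / 2 - 3 * t) := by rw [hb]; linear_combination hs2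
  rw [ea, eb]
  constructor <;> nlinarith

/-- The defect coordinate is `-(a + b)`, so eliminating it lowers each multiplicity by one, leaving
total weight `n - 3`. All three second derivatives then factor explicitly. The last bound compares
the larger well with the defect; it controls both the compressed inverse and the index. -/
theorem second_deriv_bounds_of_defect {a b n k : ℝ} (hn : 8 ≤ n) (hk : 1 ≤ k) (hkn : k ≤ n / 6)
    (hq : a ^ 2 + a * b + b ^ 2 = 1)
    (hs : (n / 2 - k - 1) * a + (n / 2 + k - 2) * b = 0) :
    1 / 6 - k / n ≤ 3 * a ^ 2 - 1 ∧ 1 / 6 - k / n ≤ 3 * b ^ 2 - 1 ∧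
      1 / 6 - k / n ≤ -(3 * (-(a + b)) ^ 2 - 1) ∧
      3 * b ^ 2 - 1 ≤ 2 * -(3 * (-(a + b)) ^ 2 - 1) := by
  have hm : 0 < n - 3 := by linarith
  obtain ⟨s, hsd⟩ : ∃ s, s = (a - b) / (n - 3) := ⟨_, rfl⟩
  have hsm : s * (n - 3) = a - b := by rw [hsd]; field_simp
  have ha : a = (n / 2 + k - 2) * s := by
    refine mul_right_cancel₀ hm.ne' ?_
    linear_combination hs - (n / 2 + k - 2) * hsm
  have hb : b = -(n / 2 - k - 1) * s := by
    refine mul_right_cancel₀ hm.ne' ?_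
    linear_combination hs + (n / 2 - k - 1) * hsm
  have hs2 : s ^ 2 * ((n / 2 + k - 2) ^ 2 - (n / 2 + k - 2) * (n / 2 - k - 1)
      + (n / 2 - k - 1) ^ 2) = 1 := by
    rw [ha, hb] at hq
    linear_combination hq
  have hs3 : 1 ≤ s ^ 2 * (n - 3) ^ 2 := by
    have : 0 ≤ (n / 2 + k - 2) * (n / 2 - k - 1) :=
      mul_nonneg (by linarith) (by linarith)
    nlinarith [mul_nonneg (sq_nonneg s) this]
  have ea : 3 * a ^ 2 - 1 = s ^ 2 * (n - 3) * (n / 2 + 3 * k - 3) := by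
    rw [ha]; linear_combination hs2
  have eb : 3 * b ^ 2 - 1 = s ^ 2 * (n - 3) * (n / 2 - 3 * k) := by
    rw [hb]; linear_combination hs2
  have e0 : -(3 * (-(a + b)) ^ 2 - 1) = s ^ 2 * (n / 2 + 3 * k - 3) * (n / 2 - 3 * k) := by
    rw [ha, hb]; linear_combination -hs2
  have hδ : 1 / 6 - k / n = (n / 2 - 3 * k) / (3 * n) := by field_simp; ring
  have hP : 0 ≤ n / 2 - 3 * k := by linarith
  have hQ : (n - 3) / 2 ≤ n / 2 + 3 * k - 3 := by linarith
  have hms : 1 / (n - 3) ≤ s ^ 2 * (n - 3) := by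
    rw [div_le_iff₀ hm]; linarith
  have hr : (n / 2 - 3 * k) / (n - 3) ≤ s ^ 2 * (n - 3) * (n / 2 - 3 * k) := by
    rw [div_eq_mul_one_div, mul_comm]
    exact mul_le_mul_of_nonneg_right hms hP
  have hsP : 0 ≤ s ^ 2 * (n / 2 - 3 * k) := mul_nonneg (sq_nonneg _) hP
  have h02 : s ^ 2 * (n - 3) * (n / 2 - 3 * k) ≤
      2 * (s ^ 2 * (n / 2 + 3 * k - 3) * (n / 2 - 3 * k)) := by
    nlinarith [mul_le_mul_of_nonneg_left hQ hsP]
  have hδ2 : (n / 2 - 3 * k) / (3 * n) ≤ (n / 2 - 3 * k) / (n - 3) / 2 := by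
    rw [div_div]
    exact div_le_div_of_nonneg_left hP (by linarith) (by linarith)
  have hr0 : 0 ≤ (n / 2 - 3 * k) / (n - 3) := div_nonneg hP hm.le
  refine ⟨?_, ?_, ?_, ?_⟩
  · rw [ea]
    have h1 : 1 / 6 - k / n ≤ 1 / 6 := by
      have : 0 ≤ k / n := div_nonneg (by linarith) (by linarith)
      linarith
    have h2 : s ^ 2 * (n - 3) * ((n - 3) / 2) ≤ s ^ 2 * (n - 3) * (n / 2 + 3 * k - 3) :=
      mul_le_mul_of_nonneg_left hQ (mul_nonneg (sq_nonneg _) hm.le)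
    linarith
  · rw [eb, hδ]; linarith
  · rw [e0, hδ]; linarith
  · rw [eb, e0]; exact h02

/-- Equality `N = 6 * k`, where the well becomes degenerate, is what non-divisibility by `3`
excludes. -/
theorem lt_div_six_of_not_dvd {N k : ℕ} (h3 : ¬ 3 ∣ N) (hk : k ≤ N / 6) : (k : ℝ) < N / 6 := by
  have : 6 * k < N := by omega
  have h : (6 : ℝ) * k < N := by exact_mod_cast this
  linarith

/-! ### Persistence of the families `B_k` and `C_k`. -/

theorem persistsOn_of_mem_B (hN : Even N) (hN8 : 8 ≤ N) (h3 : ¬ 3 ∣ N) {k : ℕ} (hk : k ≤ N / 6)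
    {y : S N} (hy : y ∈ B N k) :
    PersistsOn (Set.Icc 0 ((1 / 6 - (k : ℝ) / N) ^ 2 / 7680)) y := by
  obtain ⟨-, hidx, -, -, l, a, b, c, ⟨hab, hac, hbc⟩, ⟨ha, hb, hc⟩, hval, h0, h1, h2⟩ := hy
  have hkN := lt_div_six_of_not_dvd h3 hk
  have hNpos : (0 : ℝ) < N := by exact_mod_cast (by omega : 0 < N)
  have hsum := sum_eq_zero_of_mem y
  obtain ⟨M, hM⟩ := hN
  have hNM : (N : ℝ) = 2 * M := by rw [hM]; push_cast; ring
  rw [sum_of_three_values hab hac hbc hval, h0, h1, h2, Nat.cast_sub (by omega), Nat.cast_add,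
    show N / 2 = M by omega] at hsum
  have hq := quadratic_of_cubic_eq hbc (hb.trans hc.symm)
  have hbc' : ∀ i, y.1 i = b ∨ y.1 i = c := fun i => (hval i).resolve_left fun h => by
    have : IsEmpty {i // y.1 i = a} := by
      rcases Nat.card_eq_zero.1 h0 with h | h
      · exact h
      · exact absurd h (not_infinite_iff_finite.2 inferInstance)
    exact this.false ⟨i, h⟩
  have ht : (k : ℝ) / N < 1 / 6 := by rw [div_lt_iff₀ hNpos]; linarith
  have hw := second_deriv_ge_of_two_wells (t := k / N) (by positivity) ht.le hq (by
    have : (N : ℝ) ≠ 0 := hNpos.ne'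
    field_simp
    rw [hNM]
    push_cast at hsum
    linear_combination 2 * hsum)
  have hd : ∀ i, 1 / 6 - (k : ℝ) / N ≤ 3 * y.1 i ^ 2 - 1 := fun i => by
    rcases hbc' i with h | h <;> rw [h]
    exacts [hw.1, hw.2]
  have hpos : 0 < 1 / 6 - (k : ℝ) / N := by linarith
  have hle : 1 / 6 - (k : ℝ) / N ≤ 1 := by
    have : (0 : ℝ) ≤ k / N := by positivity
    linarith
  have hy2 : ∀ i, |y.1 i| ≤ 2 := fun i => by
    rcases hbc' i with h | h <;> rw [h]
    · exact abs_le_two_of_quadratic hq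
    · exact abs_le_two_of_quadratic (b := b) (by linarith)
  refine persistsOn_of_wellConditioned (l := l) ⟨hpos, hle, fun i => ?_, ?_⟩ hy2 (fun i => ?_)
    fun γ hγ z hz => ?_
  · exact (hd i).trans (le_abs_self _)
  · have : ∀ i, |3 * y.1 i ^ 2 - 1| = 3 * y.1 i ^ 2 - 1 := fun i =>
      abs_of_nonneg (hpos.le.trans (hd i))
    simp only [this]
    have : 0 ≤ ∑ i, 1 / (3 * y.1 i ^ 2 - 1) :=
      sum_nonneg fun i _ => one_div_nonneg.2 (hpos.le.trans (hd i))
    linarith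
  · rcases hbc' i with h | h <;> rw [h]
    exacts [hb, hc]
  · rw [hidx]
    refine morseIndex_eq_zero fun v hv => inner_hessian_pos hγ.1 hv fun i _ => ?_
    have := (abs_le.1 (abs_second_deriv_sub_le hle (hy2 i) (hz i))).1
    linarith [hd i]

/-- Only the defect has a negative entry, so the two sums differ by `2 / |d j|`. At least four sites
in the larger well contribute `2 / |d j|` more, so the defect accounts for at most a third of the
sum of absolute values. -/
theorem sum_one_div_abs_le {y : S N} {j : ZMod N} {a c A η : ℝ}
    (hd0 : η ≤ -(3 * a ^ 2 - 1)) (hd02 : 3 * c ^ 2 - 1 ≤ 2 * -(3 * a ^ 2 - 1))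
    (hd2 : η ≤ 3 * c ^ 2 - 1) (hpos : 0 < η) (hd : ∀ i, i ≠ j → η ≤ 3 * y.1 i ^ 2 - 1)
    (hj : y.1 j = a) (hac : a ≠ c) (hA4 : 4 ≤ A)
    (hcA : ∑ i, (if y.1 i = c then (1 : ℝ) else 0) = A) :
    ∑ i, 1 / |3 * y.1 i ^ 2 - 1| ≤ 3 * ∑ i, 1 / (3 * y.1 i ^ 2 - 1) := by
  have e1 : ∑ i, (1 / |3 * y.1 i ^ 2 - 1| - 1 / (3 * y.1 i ^ 2 - 1))
      = 2 * (1 / -(3 * a ^ 2 - 1)) := by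
    rw [sum_eq_single j]
    · rw [hj, abs_of_nonpos (by linarith), one_div, one_div, inv_neg]
      ring
    · intro i _ hi
      rw [abs_of_nonneg (hpos.le.trans (hd i hi)), sub_self]
    · simp
  have e2 : 1 / -(3 * a ^ 2 - 1) + A * (1 / (3 * c ^ 2 - 1)) ≤ ∑ i, 1 / |3 * y.1 i ^ 2 - 1| := by
    calc 1 / -(3 * a ^ 2 - 1) + A * (1 / (3 * c ^ 2 - 1))
        = ∑ i, ((if i = j then 1 / -(3 * a ^ 2 - 1) else 0) +
          (if y.1 i = c then (1 : ℝ) else 0) * (1 / (3 * c ^ 2 - 1))) := by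
          rw [sum_add_distrib, ← sum_mul, hcA]
          simp
      _ ≤ _ := sum_le_sum fun i _ => by
          by_cases hi : i = j
          · rw [hi, hj, if_pos rfl, if_neg hac, abs_of_nonpos (by linarith)]
            simp
          · rw [if_neg hi]
            by_cases hic : y.1 i = c
            · rw [hic, if_pos rfl, abs_of_nonneg (by linarith)]
              simp
            · rw [if_neg hic]
              simp
  have e3 : 1 / -(3 * a ^ 2 - 1) / 2 ≤ 1 / (3 * c ^ 2 - 1) := by
    rw [div_div]
    exact one_div_le_one_div_of_le (by linarith) (by linarith)
  have e4 : 4 * (1 / (3 * c ^ 2 - 1)) ≤ A * (1 / (3 * c ^ 2 - 1)) :=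
    mul_le_mul_of_nonneg_right hA4 (one_div_nonneg.2 (by linarith))
  rw [sum_sub_distrib] at e1
  linarith

theorem exists_neg_direction {y z : S N} {j : ZMod N} {a c A η γ : ℝ} (hpos : 0 < η)
    (hle : η ≤ 1) (hγ : γ ∈ Set.Icc 0 (η ^ 2 / 7680))
    (hdz : ∀ i, |(3 * z.1 i ^ 2 - 1) - (3 * y.1 i ^ 2 - 1)| ≤ η / 16) (hj : y.1 j = a)
    (hac : a ≠ c) (hA4 : 4 ≤ A) (hcA : ∑ i, (if y.1 i = c then (1 : ℝ) else 0) = A)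
    (hd0 : η ≤ -(3 * a ^ 2 - 1)) (hd02 : 3 * c ^ 2 - 1 ≤ 2 * -(3 * a ^ 2 - 1))
    (hd2 : η ≤ 3 * c ^ 2 - 1) : ∃ w : S N, inner ℝ (hessian N γ z w) w < 0 := by
  -- Unit mass at the defect, balanced by mass spread evenly over the `A ≥ 4` sites of the larger
  -- well. That well costs at most half of the gain at the defect, up to errors: `η / 16` from the
  -- displacement and `η / 16` from the coupling.
  obtain ⟨w, hw⟩ : ∃ w : ZMod N → ℝ, ∀ i, w i = (if i = j then 1 else 0) -
    1 / A * (if y.1 i = c then 1 else 0) := ⟨_, fun _ => rfl⟩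
  have hw0 : ∑ i, w i = 0 := by
    simp only [hw, sum_sub_distrib, ← mul_sum, hcA]
    rw [one_div_mul_cancel (by linarith)]
    simp
  refine ⟨toS w hw0, ?_⟩
  rw [inner_hessian]
  change ∑ i, (3 * z.1 i ^ 2 - 1) * w i * w i + γ / 2 * ∑ i, lap w i * w i < 0
  have hlap : γ / 2 * ∑ i, lap w i * w i ≤ ∑ i, η / 16 * w i ^ 2 := by
    rw [← mul_sum]
    have hw2 : 0 ≤ ∑ i, w i ^ 2 := sum_nonneg fun i _ => sq_nonneg _
    have hγ2 : 2 * γ ≤ η / 16 := by nlinarith [hγ.2]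
    nlinarith [sum_lap_mul_self_le w, hγ.1]
  have hterm : ∀ i, (3 * z.1 i ^ 2 - 1) * w i * w i + η / 16 * w i ^ 2 ≤
      (if i = j then (3 * a ^ 2 - 1) + η / 8 else 0) +
      (if y.1 i = c then (1 : ℝ) else 0) * (((3 * c ^ 2 - 1) + η / 8) * (1 / A) ^ 2) := fun i => by
    have h1 := (abs_le.1 (hdz i)).2
    have h2 : (3 * z.1 i ^ 2 - 1) * w i * w i + η / 16 * w i ^ 2 ≤
        ((3 * y.1 i ^ 2 - 1) + η / 8) * w i ^ 2 := by
      have h3 : 3 * z.1 i ^ 2 - 1 ≤ (3 * y.1 i ^ 2 - 1) + η / 16 := by linarith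
      have h4 := mul_le_mul_of_nonneg_right h3 (sq_nonneg (w i))
      linarith
    refine h2.trans (le_of_eq ?_)
    rw [hw]
    by_cases hi : i = j
    · rw [hi, hj, if_pos rfl, if_neg hac]
      simp
    · rw [if_neg hi]
      by_cases hic : y.1 i = c
      · rw [hic, if_pos rfl]
        simp [hi]
      · rw [if_neg hic]
        simp [hi]
  have hfin : ∑ i, (3 * z.1 i ^ 2 - 1) * w i * w i + ∑ i, η / 16 * w i ^ 2 ≤
      ((3 * a ^ 2 - 1) + η / 8) + A * (((3 * c ^ 2 - 1) + η / 8) * (1 / A) ^ 2) := by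
    rw [← sum_add_distrib]
    refine (sum_le_sum fun i _ => hterm i).trans (le_of_eq ?_)
    rw [sum_add_distrib, ← sum_mul, hcA]
    simp
  have hA0 : A ≠ 0 := by linarith
  have e : A * (((3 * c ^ 2 - 1) + η / 8) * (1 / A) ^ 2) = ((3 * c ^ 2 - 1) + η / 8) / A := by
    field_simp
  have e' : ((3 * c ^ 2 - 1) + η / 8) / A ≤ ((3 * c ^ 2 - 1) + η / 8) / 4 :=
    div_le_div_of_nonneg_left (by linarith) (by norm_num) hA4
  linarith

theorem persistsOn_of_mem_C (hN : Even N) (hN8 : 8 ≤ N) (h3 : ¬ 3 ∣ N) {k : ℕ} (hk1 : 1 ≤ k)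
    (hk : k ≤ N / 6) {y : S N} (hy : y ∈ C N k) :
    PersistsOn (Set.Icc 0 ((1 / 6 - (k : ℝ) / N) ^ 2 / 7680)) y := by
  obtain ⟨-, hidx, -, -, l, a, b, c, ⟨hab, hac, hbc⟩, ⟨ha, hb, hc⟩, hval, h0, h1, h2⟩ := hy
  have hkN := lt_div_six_of_not_dvd h3 hk
  have hNpos : (0 : ℝ) < N := by exact_mod_cast (by omega : 0 < N)
  have hsum := sum_eq_zero_of_mem y
  obtain ⟨M, hM⟩ := hN
  have hNM : (N : ℝ) = 2 * M := by rw [hM]; push_cast; ring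
  rw [sum_of_three_values hab hac hbc hval, h0, h1, h2, Nat.cast_sub (by omega),
    Nat.cast_sub (by omega), Nat.cast_add, show N / 2 = M by omega] at hsum
  have hq := quadratic_of_cubic_eq hbc (hb.trans hc.symm)
  have ha' := add_eq_neg_of_cubic_eq hab hac hbc (ha.trans hb.symm) (ha.trans hc.symm)
  obtain ⟨hd1, hd2, hd0, hd02⟩ := second_deriv_bounds_of_defect (n := N) (k := k)
    (by exact_mod_cast hN8) (by exact_mod_cast hk1) hkN.le hq (by
      rw [ha'] at hsum
      push_cast at hsum
      rw [hNM]
      linear_combination hsum)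
  rw [← ha'] at hd0 hd02
  obtain ⟨η, hηdef⟩ : ∃ η, η = 1 / 6 - (k : ℝ) / N := ⟨_, rfl⟩
  rw [← hηdef] at hd1 hd2 hd0 ⊢
  have hpos : 0 < η := by
    have : (k : ℝ) / N < 1 / 6 := by rw [div_lt_iff₀ hNpos]; linarith
    linarith
  have hle : η ≤ 1 := by
    have : (0 : ℝ) ≤ k / N := by positivity
    linarith
  obtain ⟨A, hA⟩ : ∃ A : ℝ, A = ((N / 2 + k - 1 : ℕ) : ℝ) := ⟨_, rfl⟩
  have hA4 : 4 ≤ A := by rw [hA]; exact_mod_cast (by omega : 4 ≤ N / 2 + k - 1)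
  have hcA : ∑ i, (if y.1 i = c then (1 : ℝ) else 0) = A := by
    rw [sum_ite_eq_natCard, h2, hA]
  obtain ⟨hsub, ⟨⟨j, hj⟩⟩⟩ := Nat.card_eq_one_iff_unique.1 h0
  have hja : ∀ i, y.1 i = a ↔ i = j := fun i =>
    ⟨fun h => congrArg Subtype.val (hsub.elim ⟨i, h⟩ ⟨j, hj⟩), fun h => h ▸ hj⟩
  have hd : ∀ i, i ≠ j → η ≤ 3 * y.1 i ^ 2 - 1 := fun i hi => by
    rcases (hval i).resolve_left (mt (hja i).1 hi) with h | h <;> rw [h]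
    exacts [hd1, hd2]
  have hy2 : ∀ i, |y.1 i| ≤ 2 := fun i => by
    rcases hval i with h | h | h <;> rw [h]
    · exact abs_le_two_of_quadratic (quadratic_of_cubic_eq hab (ha.trans hb.symm))
    · exact abs_le_two_of_quadratic hq
    · exact abs_le_two_of_quadratic (b := b) (by linarith)
  refine persistsOn_of_wellConditioned (l := l) ⟨hpos, hle, fun i => ?_, ?_⟩ hy2 (fun i => ?_)
    fun γ hγ z hz => ?_
  · by_cases hi : i = j
    · rw [hi, hj, abs_of_nonpos (by linarith)]
      exact hd0
    · exact (hd i hi).trans (le_abs_self _)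
  · exact sum_one_div_abs_le hd0 hd02 hd2 hpos hd hj hac hA4 hcA
  · rcases hval i with h | h | h <;> rw [h]
    exacts [ha, hb, hc]
  · rw [hidx]
    have hdz : ∀ i, |(3 * z.1 i ^ 2 - 1) - (3 * y.1 i ^ 2 - 1)| ≤ η / 16 := fun i =>
      abs_second_deriv_sub_le hle (hy2 i) (hz i)
    obtain ⟨w, hw⟩ := exists_neg_direction hpos hle hγ hdz hj hac hA4 hcA hd0 hd02 hd2
    refine morseIndex_eq_one hγ.1 (w := w) (j := j) (fun i hi => ?_) hw
    have := (abs_le.1 (hdz i)).1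
    linarith [hd i hi]

end ACLattice

/-! ### The balanced minima: modified force. -/

namespace ACLattice

open Finset

/-- A strongly monotone, Lipschitz function on `ℝ` that coincides with `ξ³ - ξ` on
`[7/10, 11/10]`. -/
noncomputable def monoForce (ξ : ℝ) : ℝ :=
  (max (7 / 10) (min ξ (11 / 10))) ^ 3 - max (7 / 10) (min ξ (11 / 10)) +
    2 / 5 * (ξ - max (7 / 10) (min ξ (11 / 10)))

theorem monoForce_eq {ξ : ℝ} (h1 : 7 / 10 ≤ ξ) (h2 : ξ ≤ 11 / 10) : monoForce ξ = ξ ^ 3 - ξ := by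
  rw [monoForce, min_eq_left h2, max_eq_right h1]
  ring

theorem monoForce_sub_bounds {a b : ℝ} (hab : a ≤ b) :
    2 / 5 * (b - a) ≤ monoForce b - monoForce a ∧ monoForce b - monoForce a ≤ 3 * (b - a) := by
  obtain ⟨p, hp⟩ : ∃ p, p = max (7 / 10 : ℝ) (min a (11 / 10)) := ⟨_, rfl⟩
  obtain ⟨q, hq⟩ : ∃ q, q = max (7 / 10 : ℝ) (min b (11 / 10)) := ⟨_, rfl⟩
  have hp1 : 7 / 10 ≤ p := hp ▸ le_max_left _ _
  have hq2 : q ≤ 11 / 10 := hq ▸ max_le (by norm_num) (min_le_right _ _)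
  have hpq : p ≤ q := by rw [hp, hq]; exact max_le_max le_rfl (min_le_min hab le_rfl)
  have hd : q - p ≤ b - a := by
    rw [hp, hq]
    rcases max_cases (7 / 10 : ℝ) (min a (11 / 10)) with h | h <;>
    rcases max_cases (7 / 10 : ℝ) (min b (11 / 10)) with h' | h' <;>
    rcases min_cases a (11 / 10 : ℝ) with h1 | h1 <;>
    rcases min_cases b (11 / 10 : ℝ) with h2 | h2 <;> linarith [h.1, h'.1, h.2, h'.2]
  have e : monoForce b - monoForce a = (q - p) * (q ^ 2 + q * p + p ^ 2 - 1) +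
      2 / 5 * ((b - a) - (q - p)) := by
    rw [monoForce, monoForce, ← hp, ← hq]
    ring
  -- On `[7/10, 11/10]` the slope `3 * ξ ^ 2 - 1` lies between `0.47` and `2.63`.
  have h1 : 2 / 5 ≤ q ^ 2 + q * p + p ^ 2 - 1 := by nlinarith
  have h2 : q ^ 2 + q * p + p ^ 2 - 1 ≤ 3 := by nlinarith
  have h3 := mul_le_mul_of_nonneg_left h1 (sub_nonneg.2 hpq)
  have h4 := mul_le_mul_of_nonneg_left h2 (sub_nonneg.2 hpq)
  rw [e]
  constructor <;> linarith

theorem monoForce_mono : Monotone monoForce := fun a b hab => by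
  linarith [(monoForce_sub_bounds hab).1]

theorem monoForce_one : monoForce 1 = 0 := by
  rw [monoForce_eq (by norm_num) (by norm_num)]
  norm_num

theorem mul_monoForce_sub {s : ℝ} (hs : s = 1 ∨ s = -1) (a b : ℝ) :
    2 / 5 * (a - b) ^ 2 ≤ (s * monoForce (s * a) - s * monoForce (s * b)) * (a - b) ∧
      (s * monoForce (s * a) - s * monoForce (s * b)) ^ 2 ≤ 9 * (a - b) ^ 2 := by
  have key : ∀ a b : ℝ, 2 / 5 * (a - b) ^ 2 ≤ (monoForce a - monoForce b) * (a - b) ∧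
      (monoForce a - monoForce b) ^ 2 ≤ 9 * (a - b) ^ 2 := fun a b => by
    rcases le_total b a with h | h
    · obtain ⟨h1, h2⟩ := monoForce_sub_bounds h
      constructor <;> nlinarith
    · obtain ⟨h1, h2⟩ := monoForce_sub_bounds h
      constructor <;> nlinarith
  have := key (s * a) (s * b)
  rcases hs with rfl | rfl
  · simpa using this
  · constructor <;> nlinarith [this.1, this.2]

/-! ### Maximum principle for the modified equation. -/

/-- Solutions of the stationarity equation for the modified potential whose wells are selected by
the signs `σ`. -/
structure IsModifiedSolution {N : ℕ} [NeZero N] (σ : ZMod N → ℝ) (γ : ℝ) (x : ZMod N → ℝ)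
    (l : ℝ) : Prop where
  sign : ∀ i, σ i = 1 ∨ σ i = -1
  sum_sign : ∑ i, σ i = 0
  coupling : γ ∈ Set.Icc (0 : ℝ) (1 / 10)
  sum_eq : ∑ i, x i = 0
  eqn : ∀ i, σ i * monoForce (σ i * x i) + γ / 2 * lap x i = l

namespace IsModifiedSolution

variable {N : ℕ} [NeZero N] {σ x : ZMod N → ℝ} {γ l : ℝ}

theorem neg (h : IsModifiedSolution σ γ x l) : IsModifiedSolution (-σ) γ (-x) (-l) where
  sign i := by
    rcases h.sign i with hi | hi <;> simp [hi]
  sum_sign := by simp [h.sum_sign]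
  coupling := h.coupling
  sum_eq := by simp [h.sum_eq]
  eqn i := by
    rw [← h.eqn i]
    simp only [Pi.neg_apply, neg_mul_neg, lap]
    ring

/-- At a maximum, the interaction term is nonnegative. -/
theorem eqn_le_at_max (h : IsModifiedSolution σ γ x l) {i : ZMod N} (hi : ∀ j, x j ≤ x i) :
    σ i * monoForce (σ i * x i) ≤ l := by
  have h1 : 0 ≤ lap x i := by
    rw [lap]
    linarith [hi (i + 1), hi (i - 1)]
  have h2 : 0 ≤ γ / 2 * lap x i := mul_nonneg (by linarith [h.coupling.1]) h1
  linarith [h.eqn i]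

/-- With `X` the maximum, the equation there gives `monoForce X ≤ l`, hence `X ≤ 1`; a maximum in a
negative well is impossible. Balanced signs and zero sum yield a negative-well site with value at
least `-X`. The equation there gives `l ≥ -l - 2 * γ * X`. -/
theorem neg_coupling_le (h : IsModifiedSolution σ γ x l) (hl : l ≤ 0) : -γ ≤ l := by
  obtain ⟨i, hi⟩ := Finite.exists_max x
  have hγ := h.coupling.1
  have hmax := h.eqn_le_at_max hi
  have hX : 0 ≤ x i := by
    by_contra! hneg
    have : ∑ j, x j < 0 := sum_neg (fun j _ => (hi j).trans_lt hneg) univ_nonempty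
    exact this.ne h.sum_eq
  rcases h.sign i with hs | hs
  · rw [hs, one_mul, one_mul] at hmax
    have hX1 : x i ≤ 1 := by
      by_contra! h1
      have := (monoForce_sub_bounds h1.le).1
      rw [monoForce_one] at this
      linarith
    obtain ⟨n, hn, hxn⟩ : ∃ n, σ n = -1 ∧ -x i ≤ x n := by
      by_contra! hcon
      have hneg : ∃ n, σ n = -1 := by
        by_contra! hcon'
        have h1 : ∀ j, σ j = 1 := fun j => (h.sign j).resolve_right (hcon' j)
        have h2 := h.sum_sign
        simp [h1] at h2
        exact NeZero.ne N h2
      obtain ⟨n, hn⟩ := hneg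
      have hle : ∀ j, x j ≤ σ j * x i := fun j => by
        rcases h.sign j with hj | hj
        · rw [hj, one_mul]
          exact hi j
        · rw [hj, neg_one_mul]
          exact (hcon j hj).le
      have hlt : ∑ j, x j < ∑ j, σ j * x i :=
        sum_lt_sum (fun j _ => hle j) ⟨n, mem_univ n, by rw [hn, neg_one_mul]; exact hcon n hn⟩
      rw [← sum_mul, h.sum_sign, h.sum_eq, zero_mul] at hlt
      exact lt_irrefl _ hlt
    have he := h.eqn n
    rw [hn, neg_one_mul, neg_one_mul] at he
    have hm : monoForce (-x n) ≤ monoForce (x i) := monoForce_mono (by linarith)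
    have hlap : -4 * x i ≤ lap x n := by
      rw [lap]
      linarith [hi (n + 1), hi (n - 1)]
    have h1 : γ / 2 * (-4 * x i) ≤ γ / 2 * lap x n :=
      mul_le_mul_of_nonneg_left hlap (by linarith)
    have h2 : γ * x i ≤ γ * 1 := mul_le_mul_of_nonneg_left hX1 hγ
    linarith
  · rw [hs, neg_one_mul, neg_one_mul] at hmax
    have := (monoForce_sub_bounds (show -x i ≤ 1 by linarith)).1
    rw [monoForce_one] at this
    linarith

theorem neg_one_tenth_le (h : IsModifiedSolution σ γ x l) : -(1 / 10) ≤ l := by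
  rcases le_total l 0 with hl | hl
  · linarith [h.neg_coupling_le hl, h.coupling.2]
  · linarith

theorem le_one_tenth (h : IsModifiedSolution σ γ x l) : l ≤ 1 / 10 := by
  linarith [h.neg.neg_one_tenth_le]

theorem lt_upper (h : IsModifiedSolution σ γ x l) (j : ZMod N) : x j < 11 / 10 := by
  obtain ⟨i, hi⟩ := Finite.exists_max x
  refine (hi j).trans_lt ?_
  -- The values `0.231` at `11/10` and `-0.357` at `7/10` of `ξ ^ 3 - ξ` contradict `l ≤ 1/10` in
  -- the two cases.
  by_contra! hX
  have hmax := (h.eqn_le_at_max hi).trans h.le_one_tenth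
  rcases h.sign i with hs | hs
  · rw [hs, one_mul, one_mul] at hmax
    have := monoForce_mono hX
    rw [monoForce_eq (by norm_num) le_rfl] at this
    norm_num at this
    linarith
  · rw [hs, neg_one_mul, neg_one_mul] at hmax
    have := monoForce_mono (show -x i ≤ 7 / 10 by linarith)
    rw [monoForce_eq le_rfl (by norm_num)] at this
    norm_num at this
    linarith

theorem lower_lt (h : IsModifiedSolution σ γ x l) (j : ZMod N) : -(11 / 10) < x j := by
  have := h.neg.lt_upper j
  simp only [Pi.neg_apply] at this
  linarith

theorem lower_lt_of_sign_eq_one (h : IsModifiedSolution σ γ x l) {i : ZMod N} (hs : σ i = 1) :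
    7 / 10 < x i := by
  by_contra! hx
  have he := h.eqn i
  rw [hs, one_mul, one_mul] at he
  have h1 := monoForce_mono hx
  rw [monoForce_eq le_rfl (by norm_num)] at h1
  -- The coupling contributes at most `0.18`, too little to lift a force of at most `-0.357` to `l ≥
  -- -1/10`.
  have hlap : lap x i ≤ 36 / 10 := by
    rw [lap]
    linarith [h.lower_lt (i + 1), h.lower_lt (i - 1)]
  have h2 : γ / 2 * lap x i ≤ γ / 2 * (36 / 10) :=
    mul_le_mul_of_nonneg_left hlap (by linarith [h.coupling.1])
  norm_num at h1
  linarith [h.neg_one_tenth_le, h.coupling.2]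

theorem mem_well (h : IsModifiedSolution σ γ x l) (i : ZMod N) :
    7 / 10 < σ i * x i ∧ σ i * x i < 11 / 10 := by
  rcases h.sign i with hs | hs
  · rw [hs, one_mul]
    exact ⟨h.lower_lt_of_sign_eq_one hs, h.lt_upper i⟩
  · rw [hs, neg_one_mul]
    exact ⟨h.neg.lower_lt_of_sign_eq_one (by simp [hs]), h.neg.lt_upper i⟩

theorem force_eq (h : IsModifiedSolution σ γ x l) (i : ZMod N) : force γ x i = l := by
  obtain ⟨h1, h2⟩ := h.mem_well i
  rw [← h.eqn i, monoForce_eq h1.le h2.le, force]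
  rcases h.sign i with hs | hs <;> rw [hs] <;> ring

theorem second_deriv_pos (h : IsModifiedSolution σ γ x l) (i : ZMod N) : 0 < 3 * x i ^ 2 - 1 := by
  obtain ⟨h1, -⟩ := h.mem_well i
  have : (σ i * x i) ^ 2 = x i ^ 2 := by
    rcases h.sign i with hs | hs <;> rw [hs] <;> ring
  nlinarith

end IsModifiedSolution

/-! ### Strong monotonicity and the global branch. -/

/-- Zarantonello's argument: a strongly monotone Lipschitz map has a zero. -/
theorem exists_zero_of_strongly_monotone {E : Type*} [NormedAddCommGroup E]
    [InnerProductSpace ℝ E] [CompleteSpace E] (F : E → E)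
    (hmono : ∀ x y, 2 / 5 * ‖x - y‖ ^ 2 ≤ inner ℝ (F x - F y) (x - y))
    (hlip : ∀ x y, ‖F x - F y‖ ^ 2 ≤ 19 * ‖x - y‖ ^ 2) : ∃ x, F x = 0 := by
  -- With step `1/50` the squared ratio is `1 - 4/250 + 19/2500 = 0.9916`, below `0.996 ^ 2`.
  have hc : ContractingWith (996 / 1000) (fun x => x - (1 / 50 : ℝ) • F x) := by
    refine ⟨by
      rw [← NNReal.coe_lt_coe]
      norm_num, LipschitzWith.of_dist_le_mul fun x y => ?_⟩
    rw [dist_eq_norm, dist_eq_norm]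
    refine le_of_sq_le_sq ?_ (by positivity)
    have e : (x - (1 / 50 : ℝ) • F x) - (y - (1 / 50 : ℝ) • F y)
        = (x - y) - (1 / 50 : ℝ) • (F x - F y) := by
      rw [smul_sub]
      abel
    rw [e, norm_sub_sq_real, inner_smul_right, norm_smul, mul_pow, mul_pow, real_inner_comm]
    norm_num
    nlinarith [hmono x y, hlip x y]
  refine ⟨hc.fixedPoint, ?_⟩
  have h := hc.fixedPoint_isFixedPt
  have h' : (1 / 50 : ℝ) • F (ContractingWith.fixedPoint _ hc) = 0 := sub_eq_self.1 h
  exact (smul_eq_zero.1 h').resolve_left (by norm_num)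

variable {N : ℕ} [NeZero N]

/-- The gradient of the modified constrained potential. -/
noncomputable def modifiedGradient (σ : ZMod N → ℝ) (γ : ℝ) (x : S N) : S N :=
  proj N fun i => σ i * monoForce (σ i * x.1 i) + γ / 2 * lap x.1 i

theorem norm_sq_eq_sum (v : S N) : ‖v‖ ^ 2 = ∑ i, v.1 i ^ 2 := by
  rw [← real_inner_self_eq_norm_sq, Submodule.coe_inner, inner_eq_sum]
  exact sum_congr rfl fun i _ => (sq _).symm

theorem norm_proj_sq_le (z : ZMod N → ℝ) : ‖proj N z‖ ^ 2 ≤ ∑ i, z i ^ 2 := by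
  have h1 := inner_proj z (proj N z)
  rw [real_inner_self_eq_norm_sq] at h1
  have h2 := sum_mul_sq_le_sq_mul_sq univ z (proj N z).1
  rw [← h1, ← norm_sq_eq_sum] at h2
  rcases (sq_nonneg ‖proj N z‖).eq_or_lt with h | h
  · rw [← h]
    exact sum_nonneg fun i _ => sq_nonneg _
  · rw [sq (‖proj N z‖ ^ 2)] at h2
    exact le_of_mul_le_mul_right h2 h

theorem sum_lap_sq_le (v : ZMod N → ℝ) : ∑ i, lap v i ^ 2 ≤ 16 * ∑ i, v i ^ 2 := by
  have h1 : ∑ i, v (i + 1) ^ 2 = ∑ i, v i ^ 2 :=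
    Equiv.sum_comp (Equiv.addRight (1 : ZMod N)) (fun i => v i ^ 2)
  have h2 : ∑ i, v (i - 1) ^ 2 = ∑ i, v i ^ 2 :=
    Equiv.sum_comp (Equiv.subRight (1 : ZMod N)) (fun i => v i ^ 2)
  calc ∑ i, lap v i ^ 2 ≤ ∑ i, (8 * v i ^ 2 + 4 * v (i + 1) ^ 2 + 4 * v (i - 1) ^ 2) :=
        sum_le_sum fun i _ => by
          rw [lap]
          nlinarith [sq_nonneg (v i + v (i + 1)), sq_nonneg (v i + v (i - 1)),
            sq_nonneg (v (i + 1) - v (i - 1))]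
    _ = 16 * ∑ i, v i ^ 2 := by
        rw [sum_add_distrib, sum_add_distrib, ← mul_sum, ← mul_sum, ← mul_sum, h1, h2]
        ring

variable {σ : ZMod N → ℝ}

theorem modifiedGradient_sub (γ : ℝ) (x y : S N) :
    modifiedGradient σ γ x - modifiedGradient σ γ y =
      proj N fun i => (σ i * monoForce (σ i * x.1 i) - σ i * monoForce (σ i * y.1 i)) +
        γ / 2 * lap (x - y).1 i := by
  rw [modifiedGradient, modifiedGradient, ← map_sub]
  congr 1
  funext i
  simp only [Pi.sub_apply, lap, Submodule.coe_sub, PiLp.sub_apply]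
  ring

theorem modifiedGradient_monotone (hσ : ∀ i, σ i = 1 ∨ σ i = -1) {γ : ℝ} (hγ : 0 ≤ γ)
    (x y : S N) : 2 / 5 * ‖x - y‖ ^ 2 ≤
      inner ℝ (modifiedGradient σ γ x - modifiedGradient σ γ y) (x - y) := by
  rw [modifiedGradient_sub, inner_proj, norm_sq_eq_sum]
  simp only [add_mul, sum_add_distrib, mul_assoc (γ / 2), ← mul_sum (a := γ / 2)]
  have h1 : 0 ≤ γ / 2 * ∑ i, lap (x - y).1 i * (x - y).1 i :=
    mul_nonneg (by linarith) (sum_lap_mul_self_nonneg _)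
  have h2 : 2 / 5 * ∑ i, (x - y).1 i ^ 2 ≤
      ∑ i, (σ i * monoForce (σ i * x.1 i) - σ i * monoForce (σ i * y.1 i)) * (x - y).1 i := by
    rw [mul_sum]
    exact sum_le_sum fun i _ => (mul_monoForce_sub (hσ i) (x.1 i) (y.1 i)).1
  linarith

theorem modifiedGradient_lipschitz (hσ : ∀ i, σ i = 1 ∨ σ i = -1) {γ : ℝ}
    (hγ : γ ∈ Set.Icc (0 : ℝ) (1 / 10)) (x y : S N) :
    ‖modifiedGradient σ γ x - modifiedGradient σ γ y‖ ^ 2 ≤ 19 * ‖x - y‖ ^ 2 := by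
  rw [modifiedGradient_sub, norm_sq_eq_sum (x - y)]
  refine (norm_proj_sq_le _).trans ?_
  have hg : 0 ≤ γ ^ 2 ∧ γ ^ 2 ≤ 1 / 100 := ⟨sq_nonneg _, by nlinarith [hγ.1, hγ.2]⟩
  have hterm : ∀ i, ((σ i * monoForce (σ i * x.1 i) - σ i * monoForce (σ i * y.1 i)) +
      γ / 2 * lap (x - y).1 i) ^ 2 ≤ 18 * (x - y).1 i ^ 2 + 1 / 200 * lap (x - y).1 i ^ 2 :=
    fun i => by
    have h1 : _ ≤ 9 * (x - y).1 i ^ 2 := (mul_monoForce_sub (hσ i) (x.1 i) (y.1 i)).2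
    have h2 := mul_le_mul_of_nonneg_right hg.2 (sq_nonneg (lap (x - y).1 i))
    refine add_sq_le.trans ?_
    rw [mul_pow, div_pow]
    linarith
  refine (sum_le_sum fun i _ => hterm i).trans ?_
  rw [sum_add_distrib, ← mul_sum, ← mul_sum]
  have h0 : 0 ≤ ∑ i, (x - y).1 i ^ 2 := sum_nonneg fun i _ => sq_nonneg _
  linarith [sum_lap_sq_le (x - y).1]

theorem modifiedGradient_eq_zero_unique (hσ : ∀ i, σ i = 1 ∨ σ i = -1) {γ : ℝ} (hγ : 0 ≤ γ)
    {x y : S N} (hx : modifiedGradient σ γ x = 0) (hy : modifiedGradient σ γ y = 0) : x = y := by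
  have h := modifiedGradient_monotone hσ hγ x y
  rw [hx, hy, sub_zero, inner_zero_left] at h
  have : ‖x - y‖ ^ 2 = 0 := le_antisymm (by linarith) (sq_nonneg _)
  exact sub_eq_zero.1 (norm_eq_zero.1 (pow_eq_zero_iff (two_ne_zero) |>.1 this))

/-- Strong monotonicity turns the change of the gradient at `x'` under a change of coupling into a
bound on the distance of the zeros. This makes the branch continuous. -/
theorem norm_sub_le_of_modifiedGradient_eq_zero (hσ : ∀ i, σ i = 1 ∨ σ i = -1) {γ γ' : ℝ}
    (hγ : 0 ≤ γ) {x x' : S N} (hx : modifiedGradient σ γ x = 0)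
    (hx' : modifiedGradient σ γ' x' = 0) :
    ‖x - x'‖ ≤ 5 / 4 * ‖proj N (lap x'.1)‖ * |γ - γ'| := by
  have h := modifiedGradient_monotone hσ hγ x x'
  have e : modifiedGradient σ γ x - modifiedGradient σ γ x'
      = ((γ' - γ) / 2) • proj N (lap x'.1) := by
    rw [hx, ← hx', modifiedGradient, modifiedGradient, ← map_sub, ← map_smul]
    congr 1
    funext i
    simp only [Pi.sub_apply, Pi.smul_apply, smul_eq_mul]
    ring
  rw [e] at h
  have h2 := h.trans (real_inner_le_norm _ _)
  rw [norm_smul, Real.norm_eq_abs, abs_div, abs_two, abs_sub_comm] at h2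
  rcases (norm_nonneg (x - x')).eq_or_lt with h0 | h0
  · rw [← h0]
    positivity
  · rw [sq, ← mul_assoc] at h2
    have := le_of_mul_le_mul_right h2 h0
    linarith

theorem exists_modifiedGradient_eq_zero (hσ : ∀ i, σ i = 1 ∨ σ i = -1) {γ : ℝ}
    (hγ : γ ∈ Set.Icc (0 : ℝ) (1 / 10)) : ∃ x : S N, modifiedGradient σ γ x = 0 :=
  exists_zero_of_strongly_monotone _ (modifiedGradient_monotone hσ hγ.1)
    (modifiedGradient_lipschitz hσ hγ)

/-- The configuration `y` itself serves as the sign pattern `σ`, and it is the zero of the modified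
gradient at `γ = 0`. -/
theorem persistsOn_of_sign {y : S N} (hy : ∀ i, y.1 i = 1 ∨ y.1 i = -1)
    (hindex : morseIndex N 0 y = 0) : PersistsOn (Set.Icc 0 (1 / 10)) y := by
  have hex : ∀ γ, ∃ x : S N, γ ∈ Set.Icc (0 : ℝ) (1 / 10) → modifiedGradient y.1 γ x = 0 :=
    fun γ => by
    by_cases hγ : γ ∈ Set.Icc (0 : ℝ) (1 / 10)
    · obtain ⟨x, hx⟩ := exists_modifiedGradient_eq_zero hy hγ
      exact ⟨x, fun _ => hx⟩
    · exact ⟨0, fun h => absurd h hγ⟩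
  choose x hx using hex
  refine ⟨x, fun γ' hγ' => ?_, ?_, fun γ hγ => ?_⟩
  · rw [ContinuousWithinAt, tendsto_iff_norm_sub_tendsto_zero]
    refine squeeze_zero' (Filter.Eventually.of_forall fun _ => norm_nonneg _)
      (eventually_nhdsWithin_of_forall fun γ hγ =>
        norm_sub_le_of_modifiedGradient_eq_zero hy hγ.1 (hx γ hγ) (hx γ' hγ')) ?_
    have hc : Continuous fun γ : ℝ => 5 / 4 * ‖proj N (lap (x γ').1)‖ * |γ - γ'| := by fun_prop
    have := hc.tendsto γ'
    simp only [sub_self, abs_zero, mul_zero] at this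
    exact this.mono_left nhdsWithin_le_nhds
  · refine modifiedGradient_eq_zero_unique hy le_rfl (hx 0 ⟨le_rfl, by norm_num⟩) ?_
    refine proj_eq_zero_of_const (l := 0) fun i => ?_
    have : y.1 i * y.1 i = 1 := by rcases hy i with h | h <;> rw [h] <;> norm_num
    rw [this, monoForce_one]
    simp
  · obtain ⟨l, hl⟩ := const_of_proj_eq_zero (hx γ hγ)
    have hsol : IsModifiedSolution y.1 γ (x γ).1 l :=
      ⟨hy, sum_eq_zero_of_mem y, hγ, sum_eq_zero_of_mem _, hl⟩
    have hpos : ∀ v : S N, v ≠ 0 → 0 < inner ℝ (hessian N γ (x γ) v) v := fun v hv =>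
      inner_hessian_pos hγ.1 hv fun i _ => hsol.second_deriv_pos i
    rw [hindex]
    exact ⟨isNondegStationary_of_pos hsol.force_eq hpos, morseIndex_eq_zero hpos⟩

theorem PersistsOn.mono {I J : Set ℝ} {y : S N} (h : PersistsOn J y) (hIJ : I ⊆ J) :
    PersistsOn I y := by
  obtain ⟨x, hc, h0, hx⟩ := h
  exact ⟨x, hc.mono hIJ, h0, fun γ hγ => hx γ (hIJ hγ)⟩

theorem eq_one_or_neg_one_of_mem_B_zero (hN8 : 8 ≤ N) {y : S N} (hy : y ∈ B N 0) (i : ZMod N) :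
    y.1 i = 1 ∨ y.1 i = -1 := by
  obtain ⟨-, -, -, -, l, a, b, c, ⟨hab, hac, hbc⟩, ⟨ha, hb, hc⟩, hval, h0, h1, h2⟩ := hy
  have hsum := sum_eq_zero_of_mem y
  rw [sum_of_three_values hab hac hbc hval, h0, h1, h2, Nat.sub_zero, Nat.add_zero] at hsum
  have hpos : (0 : ℝ) < (N / 2 : ℕ) := by exact_mod_cast (by omega : 0 < N / 2)
  have hcb : c = -b := by
    have : ((N / 2 : ℕ) : ℝ) * (b + c) = 0 := by
      push_cast at hsum ⊢
      linear_combination hsum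
    linarith [(mul_eq_zero.1 this).resolve_left hpos.ne']
  -- Equal occupation forces opposite wells, and then the quadratic relation reads `b ^ 2 = 1`.
  have hq := quadratic_of_cubic_eq hbc (hb.trans hc.symm)
  have hb1 : b = 1 ∨ b = -1 := sq_eq_one_iff.1 (by
    rw [hcb] at hq
    linear_combination hq)
  have : y.1 i = b ∨ y.1 i = c := (hval i).resolve_left fun h => by
    have : IsEmpty {i // y.1 i = a} := by
      rcases Nat.card_eq_zero.1 h0 with h | h
      · exact h
      · exact absurd h (not_infinite_iff_finite.2 inferInstance)
    exact this.false ⟨i, h⟩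
  rcases this with h | h <;> rcases hb1 with h' | h' <;> rw [h] <;> simp [hcb, h']

theorem persistsOn_of_mem_B_zero (hN8 : 8 ≤ N) {y : S N} (hy : y ∈ B N 0) :
    PersistsOn (Set.Ico 0 (7 / 3 - Real.sqrt 5)) y := by
  refine (persistsOn_of_sign (eq_one_or_neg_one_of_mem_B_zero hN8 hy) hy.2.1).mono fun γ hγ =>
    ⟨hγ.1, ?_⟩
  have : 67 / 30 ≤ Real.sqrt 5 := Real.le_sqrt_of_sq_le (by norm_num)
  linarith [hγ.2]

end ACLattice

theorem theorem3p3 :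
    (∃ c : ℝ, 0 < c ∧ ∀ (N : ℕ) [NeZero N], Even N → 8 ≤ N → ¬ 3 ∣ N →
      (∀ k : ℕ, k ≤ N / 6 → ∀ y ∈ ACLattice.B N k,
        ACLattice.PersistsOn (Set.Icc 0 (c * (1 / 6 - (k : ℝ) / (N : ℝ)) ^ 2)) y) ∧
      (∀ k : ℕ, 1 ≤ k → k ≤ N / 6 → ∀ y ∈ ACLattice.C N k,
        ACLattice.PersistsOn (Set.Icc 0 (c * (1 / 6 - (k : ℝ) / (N : ℝ)) ^ 2)) y)) ∧
    (∀ (N : ℕ) [NeZero N], Even N → 8 ≤ N → ¬ 3 ∣ N → ∀ y ∈ ACLattice.B N 0,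
      ACLattice.PersistsOn (Set.Ico 0 (7 / 3 - Real.sqrt 5)) y) := by
  refine ⟨⟨1 / 7680, by norm_num, fun N _ hN hN8 h3 => ⟨fun k hk y hy => ?_,
    fun k hk1 hk y hy => ?_⟩⟩, fun N _ _ hN8 _ y hy => ACLattice.persistsOn_of_mem_B_zero hN8 hy⟩
  · rw [one_div_mul_eq_div]
    exact ACLattice.persistsOn_of_mem_B hN hN8 h3 hk hy
  · rw [one_div_mul_eq_div]
    exact ACLattice.persistsOn_of_mem_C hN hN8 h3 hk1 hk hy
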